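/- Let $\mathcal S,\mathcal A$ be finite nonempty sets, $K=|\mathcal S||\mathcal A|$ and $\gamma\in[0,1)$. Consider an arbitrary MDP with state space $\mathcal S$, action space $\mathcal A$, initial distribution $p$, transition probabilities $P(\cdot|s,a)$ and rewards $r:\mathcal S\times\mathcal A\to[0,1]$. For a policy $\pi(a|s)$ put $U^\pi(p)=\mathbb E\big[\sum_{t\ge0}\gamma^t r(s_t,a_t)\big]$ with $s_0\sim p$, $a_t\sim\pi(\cdot|s_t)$, $s_{t+1}\sim P(\cdot|s_t,a_t)$, and $V^\pi(p)=(1-\gamma)U^\pi(p)$; let $U^*(p),V^*(p)$ be the maxima over all policies. The MDP is accessed only through a generative model: one call returns a sample of $p$, a sample of $P(\cdot|s,a)$, or the value $r(s,a)$, for a chosen pair $(s,a)$. Algorithm ($N\ge 1$ given). Let $\mathcal X=[0,1]^{\mathcal S}\times\Delta(\mathcal S\times\mathcal A)$ and $\eta=(1-\gamma)(KN)^{-1/2}$. Start at $x_1=(v_1,\mu_1)$ with $\mu_1$ uniform and $v_1\in[0,1]^{\mathcal S}$ arbitrary. For $n=1,\dots,N-1$, with $x_n=(v_n,\mu_n)$: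 draw $s_0\sim p$, $(s,a)\sim\mu_n$, $s'\sim P(\cdot|s,a)$ and, independently, $(\hat s,\hat a)$ uniform on $\mathcal S\times\mathcal A$, $\hat s'\sim P(\cdot|\hat s,\hat a)$; let $$g_n=\Big(e_{s_0}+\tfrac{1}{1-\gamma}(\gamma e_{s'}-e_s),\ \ K\big(\tfrac1{1-\gamma}-r(\hat s,\hat a)-\tfrac{1}{1-\gamma}(\gamma v_n(\hat s')-v_n(\hat s))\big)e_{(\hat s,\hat a)}\Big)$$ and $$x_{n+1}=\operatorname*{arg\,min}_{x\in\mathcal X}\ \langle g_n,x\rangle+\tfrac1\eta B(x\|x_n),\qquad B\big((v',\mu')\|(v,\mu)\big)=\tfrac1{2|\mathcal S|}\|v'-v\|_2^2+\mathrm{KL}(\mu'\|\mu).$$ Return the policy $\hat\pi_N(a|s)\propto\hat\mu_N(s,a)$, where $\hat\mu_N=\frac1N\sum_{n=1}^N\mu_n$. Theorem. There are absolute constants $C>0$ and $k\in\mathbb N$ such that, for all $\mathcal S,\mathcal A,\gamma,v_1$, all $\varepsilon>0$ and $\delta\in(0,1)$, and every MDP as above, with $$B_2=C\,\frac{K\max(1,\log\frac1\delta)}{(1-\gamma)^2\varepsilon^2}\,\log^k\!\Big(2+\frac{K}{(1-\gamma)\varepsilon}\Big),\qquad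 B_4=C\,\frac{K\max(1,\log\frac1\delta)}{(1-\gamma)^4\varepsilon^2}\,\log^k\!\Big(2+\frac{K}{(1-\gamma)^2\varepsilon}\Big):$$ (i) for every integer $N\ge B_2$, $V^*(p)-V^{\hat\pi_N}(p)\le\varepsilon$ with probability at least $1-\delta$, and for $N=\lceil B_2\rceil$ the algorithm always makes at most $4B_2$ calls to the generative model; (ii) for every integer $N\ge B_4$, $U^*(p)-U^{\hat\pi_N}(p)\le\varepsilon$ with probability at least $1-\delta$, and for $N=\lceil B_4\rceil$ the algorithm always makes at most $4B_4$ calls to the generative model. -/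

import Mathlib

namespace MirrorRL

noncomputable section

universe u v w

/-! ### Tabular Markov decision processes -/

/-- A tabular MDP without its discount factor: the initial distribution, the transition
probabilities, and a reward function with values in `[0, 1]`. -/
structure MDP (S : Type u) (A : Type v) where
  init : PMF S
  trans : S → A → PMF S
  reward : S → A → ℝ
  reward_mem : ∀ s a, reward s a ∈ Set.Icc (0 : ℝ) 1

/-- A (randomized, stationary) policy `π(a|s)`. -/
abbrev Policy (S : Type u) (A : Type v) : Type (max u v) := S → PMF A

/-- The law of the state at time `t` when `π` is run from the state `s`. -/
def stateLaw {S : Type u} {A : Type v} (M : MDP S A) (π : Policy S A) (s : S) : ℕ → PMF S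
  | 0 => PMF.pure s
  | t + 1 => (stateLaw M π s t).bind fun x => (π x).bind fun a => M.trans x a

/-- The expected reward `E[r(s_t, a_t)]` at time `t` when `π` is run from the state `s`. -/
def expectedReward {S : Type u} {A : Type v} [Fintype S] [Fintype A]
    (M : MDP S A) (π : Policy S A) (s : S) (t : ℕ) : ℝ :=
  ∑ x, (stateLaw M π s t x).toReal * ∑ a, (π x a).toReal * M.reward x a

/-- The conventional expected discounted sum of rewards from `s`; the series converges
absolutely for `0 ≤ γ < 1`, since rewards are in `[0, 1]`. -/
def discountedValue {S : Type u} {A : Type v} [Fintype S] [Fintype A]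
    (γ : ℝ) (M : MDP S A) (π : Policy S A) (s : S) : ℝ :=
  ∑' t : ℕ, γ ^ t * expectedReward M π s t

/-- The normalized value function `V^π(s) = (1 - γ) E[∑ γ^t r(s_t, a_t)]`. -/
def value {S : Type u} {A : Type v} [Fintype S] [Fintype A]
    (γ : ℝ) (M : MDP S A) (π : Policy S A) (s : S) : ℝ :=
  (1 - γ) * discountedValue γ M π s

/-- `E_{s ∼ p}[f(s)]` for the initial distribution `p`. -/
def initMean {S : Type u} {A : Type v} [Fintype S] (M : MDP S A) (f : S → ℝ) : ℝ :=
  ∑ s, (M.init s).toReal * f s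

/-- `π` is `ε`-optimal for the normalized return: `V^*(p) - V^π(p) ≤ ε`. -/
def IsEpsOptimal {S : Type u} {A : Type v} [Fintype S] [Fintype A]
    (γ : ℝ) (M : MDP S A) (ε : ℝ) (π : Policy S A) : Prop :=
  ∀ π' : Policy S A, initMean M (value γ M π') - initMean M (value γ M π) ≤ ε

/-- `π` is `ε`-optimal for the conventional (unnormalized) discounted return. -/
def IsEpsOptimalUnnormalized {S : Type u} {A : Type v} [Fintype S] [Fintype A]
    (γ : ℝ) (M : MDP S A) (ε : ℝ) (π : Policy S A) : Prop :=
  ∀ π' : Policy S A,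
    initMean M (discountedValue γ M π') - initMean M (discountedValue γ M π) ≤ ε

/-! ### Randomized programs with access to a generative model -/

/-- A randomized program that sees the MDP only through a generative model: it may draw an
initial state, draw a successor of a chosen state-action pair, or read the reward of a chosen
state-action pair.  `coin q` is internal randomness: a draw from a distribution `q` that the
program itself has computed. -/
inductive GenProg (S : Type u) (A : Type v) (α : Type w) : Type (max u v w) where
  | done (x : α) : GenProg S A α
  | coin (q : PMF (S × A)) (next : S × A → GenProg S A α) : GenProg S A α
  | sampleInit (next : S → GenProg S A α) : GenProg S A α
  | sampleTrans (i : S × A) (next : S → GenProg S A α) : GenProg S A α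
  | queryReward (i : S × A) (next : ℝ → GenProg S A α) : GenProg S A α

/-- The joint law of the output of a program and of the number of calls that it makes to the
generative model of `M`. -/
def GenProg.exec {S : Type u} {A : Type v} {α : Type w} (M : MDP S A) :
    GenProg S A α → PMF (α × ℕ)
  | .done x => PMF.pure (x, 0)
  | .coin q next => q.bind fun i => (next i).exec M
  | .sampleInit next =>
      M.init.bind fun s => ((next s).exec M).map fun o => (o.1, o.2 + 1)
  | .sampleTrans i next =>
      (M.trans i.1 i.2).bind fun s => ((next s).exec M).map fun o => (o.1, o.2 + 1)
  | .queryReward i next =>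
      ((next (M.reward i.1 i.2)).exec M).map fun o => (o.1, o.2 + 1)

/-! ### Stochastic mirror descent -/

/-- Pairs `(v, μ)` of a function on states and a function on state-action pairs. -/
abbrev Vec (S : Type u) (A : Type v) : Type (max u v) := (S → ℝ) × (S × A → ℝ)

/-- The decision set: `v` in the unit cube and `μ` in the probability simplex. -/
def decisionSet (S : Type u) (A : Type v) [Fintype S] [Fintype A] : Set (Vec S A) :=
  {v | ∀ s, 0 ≤ v s ∧ v s ≤ 1} ×ˢ stdSimplex ℝ (S × A)

/-- An element of the decision set. -/
abbrev Decision (S : Type u) (A : Type v) [Fintype S] [Fintype A] : Type (max u v) :=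
  {x : Vec S A // x ∈ decisionSet S A}

/-- The Bregman divergence `B_R(x' ‖ x) = ‖v' - v‖₂² / (2|S|) + KL(μ' ‖ μ)`.  It is used only
for `μ` with positive entries. -/
def bregman {S : Type u} {A : Type v} [Fintype S] [Fintype A] (x' x : Vec S A) : ℝ :=
  1 / (2 * (Fintype.card S : ℝ)) * ∑ s, (x'.1 s - x.1 s) ^ 2
    + ∑ i, x'.2 i * Real.log (x'.2 i / x.2 i)

/-- The objective `⟨g, y⟩ + B_R(y ‖ x) / η` of a mirror descent step from `x`. -/
def mdObjective {S : Type u} {A : Type v} [Fintype S] [Fintype A]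
    (η : ℝ) (g x y : Vec S A) : ℝ :=
  (∑ s, g.1 s * y.1 s + ∑ i, g.2 i * y.2 i) + 1 / η * bregman y x

theorem decisionSet_isCompact (S : Type u) (A : Type v) [Fintype S] [Fintype A] :
    IsCompact (decisionSet S A) := by
  refine IsCompact.prod ?_ (isCompact_stdSimplex ℝ (S × A))
  have h : {v : S → ℝ | ∀ s, 0 ≤ v s ∧ v s ≤ 1} = Set.univ.pi fun _ => Set.Icc (0 : ℝ) 1 := by
    ext v
    simp only [Set.mem_ofPred_eq, Set.mem_pi, Set.mem_univ, true_implies, Set.mem_Icc]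
  rw [h]
  exact isCompact_univ_pi fun _ => isCompact_Icc

theorem mdObjective_continuous {S : Type u} {A : Type v} [Fintype S] [Fintype A]
    (η : ℝ) (g x : Vec S A) : Continuous (mdObjective η g x) := by
  have key : ∀ c : ℝ, Continuous fun t : ℝ => t * Real.log (t / c) := by
    intro c
    by_cases hc : c = 0
    · simpa [hc] using continuous_const
    · have h : (fun t : ℝ => t * Real.log (t / c)) =
          fun t : ℝ => c * ((t / c) * Real.log (t / c)) := by
        funext t
        field_simp
      rw [h]
      exact continuous_const.mul
        (Real.continuous_mul_log.comp (continuous_id.div_const c))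
  unfold mdObjective bregman
  have h2 : ∀ i : S × A, Continuous fun y : Vec S A => y.2 i * Real.log (y.2 i / x.2 i) :=
    fun i => (key (x.2 i)).comp ((continuous_apply i).comp continuous_snd)
  have h3 : Continuous fun y : Vec S A => ∑ i, y.2 i * Real.log (y.2 i / x.2 i) :=
    continuous_finsetSum _ fun i _ => h2 i
  fun_prop

theorem exists_mdStep {S : Type u} {A : Type v} [Fintype S] [Fintype A]
    (η : ℝ) (g : Vec S A) (x : Decision S A) :
    ∃ y : Decision S A, ∀ z : Decision S A,
      mdObjective η g x.1 y.1 ≤ mdObjective η g x.1 z.1 := by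
  obtain ⟨y, hy, hmin⟩ := (decisionSet_isCompact S A).exists_isMinOn ⟨x.1, x.2⟩
    (mdObjective_continuous η g x.1).continuousOn
  exact ⟨⟨y, hy⟩, fun z => hmin z.2⟩

/-- The mirror descent update `argmin_{y} ⟨g, y⟩ + B_R(y ‖ x) / η` over the decision set. -/
def mdStep {S : Type u} {A : Type v} [Fintype S] [Fintype A]
    (η : ℝ) (g : Vec S A) (x : Decision S A) : Decision S A :=
  (exists_mdStep η g x).choose

/-- The `μ`-component of a decision, as a distribution on state-action pairs. -/
def flowPMF {S : Type u} {A : Type v} [Fintype S] [Fintype A] (x : Decision S A) :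
    PMF (S × A) :=
  PMF.ofFintype (fun i => ENNReal.ofReal (x.1.2 i)) (by
    obtain ⟨h0, h1⟩ := x.2.2
    rw [← ENNReal.ofReal_sum_of_nonneg fun i _ => h0 i, h1, ENNReal.ofReal_one])

/-- The policy `π_μ(a|s) ∝ μ(s, a)` (uniform at the states where `μ(s, ·) = 0`). -/
def flowPolicy {S : Type u} {A : Type v} [Fintype A] [Nonempty A]
    (μ : S × A → ℝ) : Policy S A :=
  open Classical in
  fun s =>
    if h : ∑' a, ENNReal.ofReal (μ (s, a)) ≠ 0 then
      PMF.normalize (fun a => ENNReal.ofReal (μ (s, a))) h (by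
        rw [tsum_fintype]
        exact ENNReal.sum_ne_top.2 fun a _ => ENNReal.ofReal_ne_top)
    else PMF.uniformOfFintype A

/-- The initial decision `x₁ = (v₁, μ₁)` with `μ₁` uniform. -/
def initialDecision {S : Type u} {A : Type v} [Fintype S] [Fintype A] [Nonempty S] [Nonempty A]
    (v₁ : S → ℝ) (hv₁ : ∀ s, 0 ≤ v₁ s ∧ v₁ s ≤ 1) : Decision S A :=
  ⟨(v₁, fun _ => 1 / (Fintype.card (S × A) : ℝ)), hv₁, fun _ => by positivity, by
    simp [Finset.sum_const, -Fintype.card_prod]⟩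

/-- The sampled gradient at `x = (v, μ)`.  Its `v`-part is built from an initial state `s₀`, a
state-action pair `i` drawn from `μ`, and a successor `s'` of `i`.  Its `μ`-part is supported at
a uniformly drawn state-action pair `j`, and uses the reward `r` and a successor `t'` of `j`. -/
def sampledGradient {S : Type u} {A : Type v} [Fintype S] [Fintype A]
    (γ : ℝ) (x : Vec S A) (s₀ : S) (i : S × A) (s' : S) (j : S × A) (r : ℝ) (t' : S) : Vec S A :=
  open Classical in
  (Pi.single s₀ 1 + (1 / (1 - γ)) • (γ • Pi.single s' 1 - Pi.single i.1 1),
    (Fintype.card (S × A) : ℝ) •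
      Pi.single j (1 / (1 - γ) - r - 1 / (1 - γ) * (γ * x.1 t' - x.1 j.1)))

/-- `mdLoop γ η N m x acc` performs `m` further rounds of stochastic mirror descent from the
current decision `x`, where `acc` is the sum of the earlier decisions, and returns the policy
of the average of the `N` decisions. -/
def mdLoop {S : Type u} {A : Type v} [Fintype S] [Fintype A] [Nonempty S] [Nonempty A]
    (γ η : ℝ) (N : ℕ) : ℕ → Decision S A → Vec S A → GenProg S A (Policy S A)
  | 0, x, acc => .done (flowPolicy ((1 / (N : ℝ)) • (acc + x.1)).2)
  | m + 1, x, acc =>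
      .sampleInit fun s₀ =>
      .coin (flowPMF x) fun i =>
      .sampleTrans i fun s' =>
      .coin (PMF.uniformOfFintype (S × A)) fun j =>
      .queryReward j fun r =>
      .sampleTrans j fun t' =>
      mdLoop γ η N m (mdStep η (sampledGradient γ x.1 s₀ i s' j r t') x) (acc + x.1)

/-- Mirror descent for RL with `N` decisions `x₁, …, x_N` (hence `N - 1` rounds), step size
`η = (1 - γ) (|S||A|N)^{-1/2}` and initial decision `x₁ = (v₁, uniform)`. -/
def mirrorDescentRL {S : Type u} {A : Type v} [Fintype S] [Fintype A] [Nonempty S] [Nonempty A]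
    (γ : ℝ) (v₁ : S → ℝ) (hv₁ : ∀ s, 0 ≤ v₁ s ∧ v₁ s ≤ 1) (N : ℕ) :
    GenProg S A (Policy S A) :=
  mdLoop γ ((1 - γ) / √((Fintype.card S : ℝ) * (Fintype.card A : ℝ) * (N : ℝ))) N (N - 1)
    (initialDecision v₁ hv₁) 0

/-- The bound `C |S||A| log(1/δ) / ((1 - γ)² ε²)` times the logarithmic factor
`log(2 + |S||A| / ((1 - γ) ε))^k`; here `log(1/δ)` is read as `max(1, log(1/δ))`. -/
def normalizedRate (C : ℝ) (k : ℕ) (S : Type u) (A : Type v) [Fintype S] [Fintype A]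
    (γ ε δ : ℝ) : ℝ :=
  C * ((Fintype.card S : ℝ) * (Fintype.card A : ℝ) * max 1 (Real.log (1 / δ))
      / ((1 - γ) ^ 2 * ε ^ 2))
    * Real.log (2 + (Fintype.card S : ℝ) * (Fintype.card A : ℝ) / ((1 - γ) * ε)) ^ k

/-- The bound `C |S||A| log(1/δ) / ((1 - γ)⁴ ε²)` times the logarithmic factor
`log(2 + |S||A| / ((1 - γ)² ε))^k`; here `log(1/δ)` is read as `max(1, log(1/δ))`. -/
def unnormalizedRate (C : ℝ) (k : ℕ) (S : Type u) (A : Type v) [Fintype S] [Fintype A]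
    (γ ε δ : ℝ) : ℝ :=
  C * ((Fintype.card S : ℝ) * (Fintype.card A : ℝ) * max 1 (Real.log (1 / δ))
      / ((1 - γ) ^ 4 * ε ^ 2))
    * Real.log (2 + (Fintype.card S : ℝ) * (Fintype.card A : ℝ) / ((1 - γ) ^ 2 * ε)) ^ k

end

end MirrorRL

/-!
The normalized return is the value of a linear program over occupancy measures, whose Lagrangian
is a bilinear saddle-point problem on `[0, 1]^S × Δ(S × A)`; the algorithm is stochastic mirror
descent for it. A round of mirror descent changes its regret against a fixed comparator by a drift
of order `η K / (1 - γ)²`, where `K = |S||A|`, plus the noise of the sampled gradient. The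
comparator in the simplex is the occupancy measure of a near-optimal policy, and is fixed. The
comparator in the cube has to be the value function of the learned policy, which depends on the
samples; its noise is split off with a ghost iterate that performs projected gradient descent on
the noise alone, so that what remains is measured against a point that is known before the round.

The exponential moments of the increments then multiply up over the rounds, although single
increments are as large as `K / (1 - γ)`: entries of that size are drawn with probability `1 / K`,
so the second moment is only of order `K / (1 - γ)²`. Finally, the advantages of the value
function of a policy average to zero over any flow that the policy is read off from, so the regret
against it is the suboptimality of the learned policy, up to a boundary term.
-/

namespace MirrorRL

noncomputable section

/-! ### Expectations over finite types -/

/-- The expectation of `f` under a distribution `p` on a finite type, in real arithmetic. -/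
def mean {α : Type*} [Fintype α] (p : PMF α) (f : α → ℝ) : ℝ :=
  (fun x => (p x).toReal) ⬝ᵥ f

section Mean

theorem dotProduct_mem_Icc {ι : Type*} [Fintype ι] {μ : ι → ℝ} (hμ : μ ∈ stdSimplex ℝ ι)
    {f : ι → ℝ} {a b : ℝ} (hf : ∀ i, f i ∈ Set.Icc a b) : μ ⬝ᵥ f ∈ Set.Icc a b := by
  obtain ⟨hμ_nonneg, hμ_sum⟩ := hμ
  constructor
  · calc a = ∑ i, μ i * a := by rw [← Finset.sum_mul, hμ_sum, one_mul]
      _ ≤ μ ⬝ᵥ f := Finset.sum_le_sum fun i _ => mul_le_mul_of_nonneg_left (hf i).1 (hμ_nonneg i)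
  · calc μ ⬝ᵥ f ≤ ∑ i, μ i * b :=
        Finset.sum_le_sum fun i _ => mul_le_mul_of_nonneg_left (hf i).2 (hμ_nonneg i)
      _ = b := by rw [← Finset.sum_mul, hμ_sum, one_mul]

theorem abs_dotProduct_le {ι : Type*} [Fintype ι] (g : ι → ℝ) {y : ι → ℝ} {b : ℝ}
    (hy : ∀ i, |y i| ≤ b) : |g ⬝ᵥ y| ≤ (∑ i, |g i|) * b := by
  rw [Finset.sum_mul]
  refine (Finset.abs_sum_le_sum_abs _ _).trans (Finset.sum_le_sum fun i _ => ?_)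
  rw [abs_mul]
  exact mul_le_mul_of_nonneg_left (hy i) (abs_nonneg _)

theorem sum_sq_le_of_sum_abs_le {ι : Type*} [Fintype ι] {g : ι → ℝ} {b : ℝ}
    (hg : ∑ i, |g i| ≤ b) : ∑ i, g i ^ 2 ≤ b ^ 2 := by
  calc ∑ i, g i ^ 2 = ∑ i, |g i| ^ 2 := by simp only [sq_abs]
    _ ≤ (∑ i, |g i|) ^ 2 := Finset.sum_sq_le_sq_sum_of_nonneg fun i _ => abs_nonneg _
    _ ≤ b ^ 2 := pow_le_pow_left₀ (Finset.sum_nonneg fun i _ => abs_nonneg _) hg 2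

variable {α β : Type*} [Fintype α] (p : PMF α)

theorem toReal_mem_stdSimplex : (fun x => (p x).toReal) ∈ stdSimplex ℝ α := by
  refine ⟨fun _ => ENNReal.toReal_nonneg, ?_⟩
  rw [← ENNReal.toReal_sum fun x _ => p.apply_ne_top x, ← tsum_fintype (L := .unconditional α),
    p.tsum_coe, ENNReal.toReal_one]

theorem mean_add (f g : α → ℝ) : mean p (fun x => f x + g x) = mean p f + mean p g :=
  dotProduct_add _ f g

theorem mean_sub (f g : α → ℝ) : mean p (fun x => f x - g x) = mean p f - mean p g :=
  dotProduct_sub _ f g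

theorem mean_const_mul (c : ℝ) (f : α → ℝ) : mean p (fun x => c * f x) = c * mean p f :=
  dotProduct_smul c _ f

theorem mean_mono {f g : α → ℝ} (h : ∀ x, f x ≤ g x) : mean p f ≤ mean p g :=
  dotProduct_le_dotProduct_of_nonneg_left h fun _ => ENNReal.toReal_nonneg

theorem mean_mem_Icc {f : α → ℝ} {a b : ℝ} (h : ∀ x, f x ∈ Set.Icc a b) :
    mean p f ∈ Set.Icc a b :=
  dotProduct_mem_Icc (toReal_mem_stdSimplex p) h

theorem mean_const (c : ℝ) : mean p (fun _ => c) = c :=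
  le_antisymm (mean_mem_Icc p fun _ => ⟨le_rfl, le_rfl⟩).2
    (mean_mem_Icc p fun _ => ⟨le_rfl, le_rfl⟩).1

theorem abs_mean_le {f : α → ℝ} {b : ℝ} (h : ∀ x, |f x| ≤ b) : |mean p f| ≤ b :=
  abs_le.2 (mean_mem_Icc p fun x => abs_le.1 (h x))

theorem abs_mean_le_mean_abs (f : α → ℝ) : |mean p f| ≤ mean p fun x => |f x| := by
  refine (Finset.abs_sum_le_sum_abs _ _).trans_eq (Finset.sum_congr rfl fun x _ => ?_)
  rw [abs_mul, abs_of_nonneg ENNReal.toReal_nonneg]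

theorem mean_pure (a : α) (f : α → ℝ) : mean (PMF.pure a) f = f a := by
  classical
  have pure_eq_single : (fun x => (PMF.pure a x).toReal) = Pi.single a 1 := by
    ext x
    by_cases h : x = a <;> simp [h]
  rw [mean, pure_eq_single, single_one_dotProduct]

theorem mean_bind [Fintype β] (q : α → PMF β) (f : β → ℝ) :
    mean (p.bind q) f = mean p fun x => mean (q x) f := by
  have toReal_bind (y : β) : (p.bind q y).toReal = ∑ x, (p x).toReal * (q x y).toReal := by
    rw [PMF.bind_apply, tsum_fintype, ENNReal.toReal_sum fun x _ =>
      ENNReal.mul_ne_top (p.apply_ne_top x) ((q x).apply_ne_top y)]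
    simp only [ENNReal.toReal_mul]
  simp only [mean, dotProduct, toReal_bind, Finset.sum_mul, Finset.mul_sum, mul_assoc]
  exact Finset.sum_comm

theorem mean_uniform [Nonempty α] (f : α → ℝ) :
    mean (PMF.uniformOfFintype α) f = 1 / (Fintype.card α : ℝ) * ∑ x, f x := by
  simp only [mean, dotProduct, PMF.uniformOfFintype_apply, ENNReal.toReal_inv,
    ENNReal.toReal_natCast, Finset.mul_sum, one_div]

theorem mean_sum {ι : Type*} [Fintype ι] (f : ι → α → ℝ) :
    mean p (fun x => ∑ i, f i x) = ∑ i, mean p (f i) := by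
  simp only [mean, dotProduct, Finset.mul_sum]
  exact Finset.sum_comm

theorem mean_dotProduct {ι : Type*} [Fintype ι] (g : α → ι → ℝ) (y : ι → ℝ) :
    mean p (fun x => g x ⬝ᵥ y) = (fun i => mean p fun x => g x i) ⬝ᵥ y := by
  simp only [dotProduct, mean_sum, mul_comm _ (y _), mean_const_mul]

theorem mean_tsum {f : α → ℕ → ℝ} (hf : ∀ x, Summable (f x)) :
    mean p (fun x => ∑' t, f x t) = ∑' t, mean p fun x => f x t := by
  simp only [mean, dotProduct, ← tsum_mul_left]
  exact (Summable.tsum_finsetSum fun x _ => (hf x).mul_left _).symm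

theorem mean_exp_le {Y : α → ℝ} {l m σ : ℝ} (hl : 0 ≤ l) (hY : ∀ x, |l * Y x| ≤ 1)
    (hm : mean p Y ≤ m) (hσ : mean p (fun x => Y x ^ 2) ≤ σ) :
    mean p (fun x => Real.exp (l * Y x)) ≤ Real.exp (l * m + l ^ 2 * σ) := by
  have exp_le (x : α) : Real.exp (l * Y x) ≤ 1 + (l * Y x + l ^ 2 * Y x ^ 2) := by
    linarith [(abs_le.1 (Real.abs_exp_sub_one_sub_id_le (hY x))).2, mul_pow l (Y x) 2]
  calc mean p (fun x => Real.exp (l * Y x))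
      ≤ mean p fun x => 1 + (l * Y x + l ^ 2 * Y x ^ 2) := mean_mono p exp_le
    _ = 1 + (l * mean p Y + l ^ 2 * mean p fun x => Y x ^ 2) := by
        rw [mean_add, mean_const, mean_add, mean_const_mul, mean_const_mul]
    _ ≤ 1 + (l * m + l ^ 2 * σ) := by gcongr
    _ ≤ Real.exp (l * m + l ^ 2 * σ) := by
        linarith [Real.add_one_le_exp (l * m + l ^ 2 * σ)]

end Mean

/-! ### Values, occupancy measures and the Lagrangian -/

section Value

variable {S A : Type*} {γ : ℝ} (M : MDP S A) (π : Policy S A)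

/-- The law of the next state when `π` is run for one step from `s`. -/
def policyStep (s : S) : PMF S :=
  (π s).bind fun a => M.trans s a

/-- The law of the state at time `t` when `π` is run from the initial distribution. -/
def initLaw (t : ℕ) : PMF S :=
  M.init.bind fun s => stateLaw M π s t

/-- The effective horizon `∑ₜ γ ^ t = 1 / (1 - γ)` of the discount factor `γ`. -/
def horizon (γ : ℝ) : ℝ :=
  1 / (1 - γ)

theorem one_le_horizon (h0 : 0 ≤ γ) (h1 : γ < 1) : 1 ≤ horizon γ :=
  one_le_one_div (sub_pos.2 h1) (sub_le_self 1 h0)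

theorem one_sub_mul_horizon (h1 : γ < 1) : (1 - γ) * horizon γ = 1 :=
  mul_one_div_cancel (sub_pos.2 h1).ne'

theorem stateLaw_succ_eq_bind (s : S) (t : ℕ) :
    stateLaw M π s (t + 1) = (policyStep M π s).bind fun y => stateLaw M π y t := by
  induction t with
  | zero =>
    simp only [stateLaw, PMF.pure_bind, PMF.bind_pure]
    rfl
  | succ t ih =>
    rw [stateLaw, ih, PMF.bind_bind]
    rfl

theorem initLaw_zero : initLaw M π 0 = M.init :=
  PMF.bind_pure _

theorem initLaw_succ (t : ℕ) : initLaw M π (t + 1) = (initLaw M π t).bind (policyStep M π) := by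
  rw [initLaw, initLaw, PMF.bind_bind]
  rfl

theorem summable_geometric_mul_of_abs_le (h0 : 0 ≤ γ) (h1 : γ < 1) {f : ℕ → ℝ} {b : ℝ}
    (hf : ∀ t, |f t| ≤ b) : Summable fun t => γ ^ t * f t := by
  refine Summable.of_norm_bounded ((summable_geometric_of_lt_one h0 h1).mul_right b) fun t => ?_
  rw [Real.norm_eq_abs, abs_mul, abs_of_nonneg (pow_nonneg h0 t)]
  exact mul_le_mul_of_nonneg_left (hf t) (pow_nonneg h0 t)

variable [Fintype S]

/-- The expected one-step change `γ E[v(s')] - v(s)`, where `s' ∼ P(· | s, a)` for the pair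
`i = (s, a)`. -/
def discountedDrift (γ : ℝ) (M : MDP S A) (v : S → ℝ) (i : S × A) : ℝ :=
  γ * mean (M.trans i.1 i.2) v - v i.1

/-- The normalized advantage `r(s, a) + (γ E[v(s')] - v(s)) / (1 - γ)` of a pair `i = (s, a)`
over a function `v` on states. -/
def advantage (γ : ℝ) (M : MDP S A) (v : S → ℝ) (i : S × A) : ℝ :=
  M.reward i.1 i.2 + horizon γ * discountedDrift γ M v i

/-- The normalized discounted state occupancy `(1 - γ) ∑ₜ γ ^ t ℙ(sₜ = s)` of `π`, with
`s₀` drawn from the initial distribution. -/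
def stateOccupancy (γ : ℝ) (M : MDP S A) (π : Policy S A) (s : S) : ℝ :=
  (1 - γ) * ∑' t, γ ^ t * (initLaw M π t s).toReal

/-- The normalized discounted occupancy of state-action pairs of `π`. -/
def occupancy (γ : ℝ) (M : MDP S A) (π : Policy S A) (i : S × A) : ℝ :=
  stateOccupancy γ M π i.1 * (π i.1 i.2).toReal

theorem stateOccupancy_dotProduct (h0 : 0 ≤ γ) (h1 : γ < 1) (f : S → ℝ) :
    stateOccupancy γ M π ⬝ᵥ f = (1 - γ) * ∑' t, γ ^ t * mean (initLaw M π t) f := by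
  have summable_apply (s : S) : Summable fun t => γ ^ t * (initLaw M π t s).toReal :=
    summable_geometric_mul_of_abs_le h0 h1 (b := 1) fun t => by
      rw [abs_of_nonneg ENNReal.toReal_nonneg]
      exact (mem_Icc_of_mem_stdSimplex (toReal_mem_stdSimplex _) s).2
  simp only [stateOccupancy, dotProduct, mean, Finset.mul_sum, mul_assoc, ← tsum_mul_right]
  rw [Summable.tsum_finsetSum fun s _ => by
    simpa only [mul_assoc] using (summable_apply s).mul_right (f s), Finset.mul_sum]

theorem stateOccupancy_flow (h0 : 0 ≤ γ) (h1 : γ < 1) (v : S → ℝ) :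
    (stateOccupancy γ M π ⬝ᵥ fun s => γ * mean (policyStep M π s) v - v s) =
      -((1 - γ) * initMean M v) := by
  have summable_mean : Summable fun t => γ ^ t * mean (initLaw M π t) v := by
    refine summable_geometric_mul_of_abs_le h0 h1 (b := ∑ s, |v s|) fun t =>
      abs_mean_le _ fun s => ?_
    exact Finset.single_le_sum (f := fun s => |v s|) (fun _ _ => abs_nonneg _) (Finset.mem_univ s)
  have telescoping (t : ℕ) :
      γ ^ t * mean (initLaw M π t) (fun s => γ * mean (policyStep M π s) v - v s) =
        γ ^ (t + 1) * mean (initLaw M π (t + 1)) v - γ ^ t * mean (initLaw M π t) v := by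
    rw [mean_sub, mean_const_mul, initLaw_succ, mean_bind]
    ring
  rw [stateOccupancy_dotProduct M π h0 h1]
  simp only [telescoping]
  rw [((summable_nat_add_iff 1).2 summable_mean).tsum_sub summable_mean,
    summable_mean.tsum_eq_zero_add, pow_zero, one_mul, initLaw_zero, sub_add_cancel_right,
    mul_neg]
  rfl

variable [Fintype A]

theorem mean_advantage (v : S → ℝ) (s : S) :
    mean (π s) (fun a => advantage γ M v (s, a)) =
      mean (π s) (M.reward s) + horizon γ * (γ * mean (policyStep M π s) v - v s) := by
  simp only [advantage, discountedDrift]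
  rw [mean_add, mean_const_mul, mean_sub, mean_const_mul, mean_const, policyStep, mean_bind]

theorem occupancy_dotProduct (f : S × A → ℝ) :
    occupancy γ M π ⬝ᵥ f = stateOccupancy γ M π ⬝ᵥ fun s => mean (π s) fun a => f (s, a) := by
  simp only [dotProduct, mean, occupancy, Fintype.sum_prod_type, Finset.mul_sum, mul_assoc]

theorem occupancy_mem_stdSimplex (h0 : 0 ≤ γ) (h1 : γ < 1) :
    occupancy γ M π ∈ stdSimplex ℝ (S × A) := by
  have hpos : 0 < 1 - γ := sub_pos.2 h1
  refine ⟨fun i => mul_nonneg (mul_nonneg hpos.le (tsum_nonneg fun t => ?_))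
    ENNReal.toReal_nonneg, ?_⟩
  · exact mul_nonneg (pow_nonneg h0 t) ENNReal.toReal_nonneg
  · rw [← dotProduct_one, occupancy_dotProduct]
    simp only [Pi.one_apply, stateOccupancy_dotProduct M π h0 h1, mean_const, mul_one]
    rw [tsum_geometric_of_lt_one h0 h1, mul_inv_cancel₀ hpos.ne']

theorem expectedReward_mem_Icc (s : S) (t : ℕ) : expectedReward M π s t ∈ Set.Icc (0 : ℝ) 1 :=
  mean_mem_Icc _ fun x => mean_mem_Icc _ fun a => M.reward_mem x a

theorem expectedReward_zero (s : S) : expectedReward M π s 0 = mean (π s) (M.reward s) :=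
  mean_pure s fun x => mean (π x) (M.reward x)

theorem expectedReward_succ (s : S) (t : ℕ) :
    expectedReward M π s (t + 1) = mean (policyStep M π s) fun y => expectedReward M π y t := by
  change mean (stateLaw M π s (t + 1)) _ = _
  rw [stateLaw_succ_eq_bind, mean_bind]
  rfl

theorem summable_expectedReward (h0 : 0 ≤ γ) (h1 : γ < 1) (s : S) :
    Summable fun t => γ ^ t * expectedReward M π s t :=
  summable_geometric_mul_of_abs_le h0 h1 fun t =>
    (abs_of_nonneg (expectedReward_mem_Icc M π s t).1).trans_le (expectedReward_mem_Icc M π s t).2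

theorem value_mem_Icc (h0 : 0 ≤ γ) (h1 : γ < 1) (s : S) : value γ M π s ∈ Set.Icc (0 : ℝ) 1 := by
  have hpos : 0 < 1 - γ := sub_pos.2 h1
  constructor
  · exact mul_nonneg hpos.le
      (tsum_nonneg fun t => mul_nonneg (pow_nonneg h0 t) (expectedReward_mem_Icc M π s t).1)
  · calc (1 - γ) * ∑' t, γ ^ t * expectedReward M π s t ≤ (1 - γ) * ∑' t, γ ^ t := by
          gcongr
          · exact summable_expectedReward M π h0 h1 s
          · exact summable_geometric_of_lt_one h0 h1
          · exact mul_le_of_le_one_right (pow_nonneg h0 _) (expectedReward_mem_Icc M π s _).2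
      _ = 1 := by rw [tsum_geometric_of_lt_one h0 h1, mul_inv_cancel₀ hpos.ne']

theorem initMean_value_mem_Icc (h0 : 0 ≤ γ) (h1 : γ < 1) :
    initMean M (value γ M π) ∈ Set.Icc (0 : ℝ) 1 :=
  mean_mem_Icc M.init (value_mem_Icc M π h0 h1)

theorem discountedValue_eq_add (h0 : 0 ≤ γ) (h1 : γ < 1) (s : S) :
    discountedValue γ M π s =
      mean (π s) (M.reward s) + γ * mean (policyStep M π s) (discountedValue γ M π) := by
  have mean_discountedValue : mean (policyStep M π s) (discountedValue γ M π) =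
      ∑' t, mean (policyStep M π s) fun y => γ ^ t * expectedReward M π y t :=
    mean_tsum _ fun y => summable_expectedReward M π h0 h1 y
  rw [mean_discountedValue, discountedValue,
    (summable_expectedReward M π h0 h1 s).tsum_eq_zero_add, pow_zero, one_mul,
    expectedReward_zero, ← tsum_mul_left]
  simp only [expectedReward_succ, mean_const_mul, pow_succ', mul_assoc]

theorem mean_advantage_value (h0 : 0 ≤ γ) (h1 : γ < 1) (s : S) :
    mean (π s) (fun a => advantage γ M (value γ M π) (s, a)) = 0 := by
  have mean_value : mean (policyStep M π s) (value γ M π) =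
      (1 - γ) * mean (policyStep M π s) (discountedValue γ M π) := mean_const_mul _ _ _
  rw [mean_advantage, mean_value, value]
  linear_combination (γ * mean (policyStep M π s) (discountedValue γ M π) -
    discountedValue γ M π s) * one_sub_mul_horizon h1 - discountedValue_eq_add M π h0 h1 s

/-- The Lagrangian of the linear program for the optimal normalized return: the primal variable
`v` is a function on states, the dual variable `μ` a function on state-action pairs. -/
def lagrangian (γ : ℝ) (M : MDP S A) (v : S → ℝ) (μ : S × A → ℝ) : ℝ :=
  initMean M v + μ ⬝ᵥ advantage γ M v

theorem lagrangian_occupancy (h0 : 0 ≤ γ) (h1 : γ < 1) (v : S → ℝ) :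
    lagrangian γ M v (occupancy γ M π) = initMean M (value γ M π) := by
  have mean_advantage_eq (s : S) : mean (π s) (fun a => advantage γ M v (s, a)) =
      horizon γ * ((γ * mean (policyStep M π s) v - v s) -
        (γ * mean (policyStep M π s) (value γ M π) - value γ M π s)) := by
    linear_combination mean_advantage (γ := γ) M π v s -
      mean_advantage (γ := γ) M π (value γ M π) s + mean_advantage_value M π h0 h1 s
  rw [lagrangian, occupancy_dotProduct]
  simp only [mean_advantage_eq]
  change _ + _ ⬝ᵥ (horizon γ • ((fun s => γ * mean (policyStep M π s) v - v s) -
    fun s => γ * mean (policyStep M π s) (value γ M π) - value γ M π s)) = _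
  rw [dotProduct_smul, dotProduct_sub, stateOccupancy_flow M π h0 h1,
    stateOccupancy_flow M π h0 h1, smul_eq_mul]
  linear_combination (initMean M (value γ M π) - initMean M v) * one_sub_mul_horizon h1

end Value

section FlowPolicy

variable {S A : Type*} [Fintype A] [Nonempty A] {μ : S × A → ℝ}

theorem sum_mul_flowPolicy (hμ : ∀ i, 0 ≤ μ i) (s : S) (a : A) :
    (∑ b, μ (s, b)) * (flowPolicy μ s a).toReal = μ (s, a) := by
  have sum_ofReal : ∑' b, ENNReal.ofReal (μ (s, b)) = ENNReal.ofReal (∑ b, μ (s, b)) := by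
    rw [tsum_fintype, ENNReal.ofReal_sum_of_nonneg fun b _ => hμ _]
  have sum_nonneg : 0 ≤ ∑ b, μ (s, b) := Finset.sum_nonneg fun b _ => hμ _
  by_cases h : ∑' b, ENNReal.ofReal (μ (s, b)) = 0
  · have sum_eq_zero : ∑ b, μ (s, b) = 0 :=
      le_antisymm (ENNReal.ofReal_eq_zero.1 (sum_ofReal.symm.trans h)) sum_nonneg
    rw [sum_eq_zero, zero_mul,
      (Finset.sum_eq_zero_iff_of_nonneg fun b _ => hμ (s, b)).1 sum_eq_zero a (Finset.mem_univ a)]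
  · have sum_ne_zero : ∑ b, μ (s, b) ≠ 0 := fun h' =>
      h (by rw [sum_ofReal, h', ENNReal.ofReal_zero])
    rw [flowPolicy, dif_pos h, PMF.normalize_apply, sum_ofReal, ENNReal.toReal_mul,
      ENNReal.toReal_inv, ENNReal.toReal_ofReal (hμ _), ENNReal.toReal_ofReal sum_nonneg]
    field_simp

theorem dotProduct_eq_sum_mul_mean_flowPolicy [Fintype S] (hμ : ∀ i, 0 ≤ μ i) (f : S × A → ℝ) :
    μ ⬝ᵥ f = ∑ s, (∑ b, μ (s, b)) * mean (flowPolicy μ s) fun a => f (s, a) := by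
  simp only [mean, dotProduct, Finset.mul_sum, Fintype.sum_prod_type]
  refine Finset.sum_congr rfl fun s _ => Finset.sum_congr rfl fun a _ => ?_
  rw [← mul_assoc, sum_mul_flowPolicy hμ]

theorem dotProduct_advantage_value_flowPolicy [Fintype S] {γ : ℝ} (h0 : 0 ≤ γ) (h1 : γ < 1)
    (M : MDP S A) (hμ : ∀ i, 0 ≤ μ i) :
    μ ⬝ᵥ advantage γ M (value γ M (flowPolicy μ)) = 0 := by
  simp only [dotProduct_eq_sum_mul_mean_flowPolicy hμ, mean_advantage_value M _ h0 h1, mul_zero,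
    Finset.sum_const_zero]

end FlowPolicy

/-! ### Mirror steps in the cube and in the simplex -/

section CubeStep

variable {S : Type*}

/-- The projected gradient step `x ↦ proj (x - β g)` for the unit cube. -/
def cubeStep (β : ℝ) (g x : S → ℝ) (s : S) : ℝ :=
  Set.projIcc (0 : ℝ) 1 zero_le_one (x s - β * g s)

theorem cubeStep_mem_Icc (β : ℝ) (g x : S → ℝ) (s : S) : cubeStep β g x s ∈ Set.Icc (0 : ℝ) 1 :=
  Subtype.coe_prop _

theorem sq_projIcc_sub_add_sq_sub_projIcc_le {a b : ℝ} (hab : a ≤ b) (c : ℝ) {y : ℝ}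
    (hy : y ∈ Set.Icc a b) :
    ((Set.projIcc a b hab c : ℝ) - c) ^ 2 + (y - Set.projIcc a b hab c) ^ 2 ≤ (y - c) ^ 2 := by
  obtain ⟨hay, hyb⟩ := hy
  rw [Set.coe_projIcc]
  rcases le_total b c with hbc | hcb
  · rw [min_eq_left hbc, max_eq_right hab]
    nlinarith
  rw [min_eq_right hcb]
  rcases le_total a c with hac | hca
  · rw [max_eq_right hac]
    nlinarith
  · rw [max_eq_left hca]
    nlinarith

variable [Fintype S] {β : ℝ} (g x : S → ℝ) {q : S → ℝ}

theorem dotProduct_cubeStep_add_le (hβ : 0 < β) (hq : ∀ s, q s ∈ Set.Icc (0 : ℝ) 1) :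
    g ⬝ᵥ cubeStep β g x + 1 / (2 * β) * ∑ s, (cubeStep β g x s - x s) ^ 2
        + 1 / (2 * β) * ∑ s, (q s - cubeStep β g x s) ^ 2 ≤
      g ⬝ᵥ q + 1 / (2 * β) * ∑ s, (q s - x s) ^ 2 := by
  have completed_square (s : S) (y : ℝ) : g s * y + 1 / (2 * β) * (y - x s) ^ 2 =
      1 / (2 * β) * (y - (x s - β * g s)) ^ 2 + (g s * x s - β / 2 * g s ^ 2) := by
    field_simp
    ring
  simp only [dotProduct, Finset.mul_sum, ← Finset.sum_add_distrib]
  refine Finset.sum_le_sum fun s _ => ?_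
  rw [completed_square, completed_square]
  have pythagoras : 1 / (2 * β) * ((cubeStep β g x s - (x s - β * g s)) ^ 2
      + (q s - cubeStep β g x s) ^ 2) ≤ 1 / (2 * β) * (q s - (x s - β * g s)) ^ 2 := by
    gcongr
    exact sq_projIcc_sub_add_sq_sub_projIcc_le zero_le_one _ (hq s)
  linarith

theorem dotProduct_sub_le_of_cubeStep (hβ : 0 < β) (hq : ∀ s, q s ∈ Set.Icc (0 : ℝ) 1) :
    g ⬝ᵥ (x - q) ≤
      1 / (2 * β) * (∑ s, (q s - x s) ^ 2 - ∑ s, (q s - cubeStep β g x s) ^ 2)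
        + β / 2 * ∑ s, g s ^ 2 := by
  have three_point := dotProduct_cubeStep_add_le g x hβ hq
  have young : g ⬝ᵥ x - g ⬝ᵥ cubeStep β g x ≤
      1 / (2 * β) * ∑ s, (cubeStep β g x s - x s) ^ 2 + β / 2 * ∑ s, g s ^ 2 := by
    rw [← dotProduct_sub]
    simp only [dotProduct, Pi.sub_apply, Finset.mul_sum, ← Finset.sum_add_distrib]
    refine Finset.sum_le_sum fun s _ => ?_
    have square_nonneg : 0 ≤ 1 / (2 * β) * (cubeStep β g x s - x s + β * g s) ^ 2 := by positivity
    have square_eq : 1 / (2 * β) * (cubeStep β g x s - x s + β * g s) ^ 2 =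
        1 / (2 * β) * (cubeStep β g x s - x s) ^ 2 + β / 2 * g s ^ 2
          - g s * (x s - cubeStep β g x s) := by
      field_simp
      ring
    linarith
  rw [dotProduct_sub]
  linarith

end CubeStep

section ExpUpdate

variable {ι : Type*} [Fintype ι] {μ ν : ι → ℝ}

/-- The Kullback-Leibler divergence `∑ ν log (ν / μ)` of weights on a finite type; it is used
only for `μ` with positive entries. -/
def klSum (ν μ : ι → ℝ) : ℝ :=
  ∑ i, ν i * Real.log (ν i / μ i)

theorem klSum_eq_sum_klFun (hμ : ∀ i, 0 < μ i) (h : ∑ i, ν i = ∑ i, μ i) :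
    klSum ν μ = ∑ i, μ i * InformationTheory.klFun (ν i / μ i) := by
  have mul_klFun (i : ι) : μ i * InformationTheory.klFun (ν i / μ i) =
      ν i * Real.log (ν i / μ i) + (μ i - ν i) := by
    have := (hμ i).ne'
    rw [InformationTheory.klFun]
    field_simp
    ring
  simp only [mul_klFun, Finset.sum_add_distrib, Finset.sum_sub_distrib, h, sub_self, add_zero]
  rfl

theorem klSum_nonneg (hμ : ∀ i, 0 < μ i) (hν : ∀ i, 0 ≤ ν i) (h : ∑ i, ν i = ∑ i, μ i) :
    0 ≤ klSum ν μ := by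
  rw [klSum_eq_sum_klFun hμ h]
  exact Finset.sum_nonneg fun i _ => mul_nonneg (hμ i).le
    (InformationTheory.klFun_nonneg (div_nonneg (hν i) (hμ i).le))

theorem eq_of_klSum_nonpos (hμ : ∀ i, 0 < μ i) (hν : ∀ i, 0 ≤ ν i) (h : ∑ i, ν i = ∑ i, μ i)
    (hle : klSum ν μ ≤ 0) : ν = μ := by
  have div_nonneg (i : ι) : 0 ≤ ν i / μ i := div_nonneg (hν i) (hμ i).le
  have terms_eq_zero := le_antisymm hle (klSum_nonneg hμ hν h)
  rw [klSum_eq_sum_klFun hμ h, Finset.sum_eq_zero_iff_of_nonneg fun i _ =>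
    mul_nonneg (hμ i).le (InformationTheory.klFun_nonneg (div_nonneg i))] at terms_eq_zero
  funext i
  have klFun_eq_zero :=
    (mul_eq_zero.1 (terms_eq_zero i (Finset.mem_univ i))).resolve_left (hμ i).ne'
  rwa [InformationTheory.klFun_eq_zero_iff (div_nonneg i), div_eq_one_iff_eq (hμ i).ne']
    at klFun_eq_zero

theorem klSum_self (hμ : ∀ i, 0 < μ i) : klSum μ μ = 0 :=
  Finset.sum_eq_zero fun i _ => by rw [div_self (hμ i).ne', Real.log_one, mul_zero]

theorem klSum_uniform_le (hν : ν ∈ stdSimplex ℝ ι) :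
    klSum ν (fun _ => 1 / (Fintype.card ι : ℝ)) ≤ Real.log (Fintype.card ι) := by
  have term_le (i : ι) :
      ν i * Real.log (ν i / (1 / (Fintype.card ι : ℝ))) ≤ ν i * Real.log (Fintype.card ι) := by
    obtain ⟨h0, h1⟩ := mem_Icc_of_mem_stdSimplex hν i
    have card_pos : (0 : ℝ) < Fintype.card ι := Nat.cast_pos.2 (Fintype.card_pos_iff.2 ⟨i⟩)
    rcases h0.eq_or_lt with h | h
    · rw [← h, zero_mul, zero_mul]
    · rw [div_div_eq_mul_div, div_one]
      gcongr
      exact mul_le_of_le_one_left card_pos.le h1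
  calc klSum ν (fun _ => 1 / (Fintype.card ι : ℝ))
      ≤ ∑ i, ν i * Real.log (Fintype.card ι) := Finset.sum_le_sum fun i _ => term_le i
    _ = Real.log (Fintype.card ι) := by rw [← Finset.sum_mul, hν.2, one_mul]

/-- The normalizing constant of the exponential weights update. -/
def expPartition (η : ℝ) (g μ : ι → ℝ) : ℝ :=
  ∑ i, μ i * Real.exp (-(η * g i))

/-- The exponential weights update `μ ↦ μ exp (-η g) / Z`. -/
def expUpdate (η : ℝ) (g μ : ι → ℝ) (i : ι) : ℝ :=
  μ i * Real.exp (-(η * g i)) / expPartition η g μ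

variable [Nonempty ι] {η : ℝ} (g : ι → ℝ)

theorem expPartition_pos (η : ℝ) (hμ : ∀ i, 0 < μ i) : 0 < expPartition η g μ :=
  Finset.sum_pos (fun i _ => mul_pos (hμ i) (Real.exp_pos _)) Finset.univ_nonempty

theorem expUpdate_pos (η : ℝ) (hμ : ∀ i, 0 < μ i) (i : ι) : 0 < expUpdate η g μ i :=
  div_pos (mul_pos (hμ i) (Real.exp_pos _)) (expPartition_pos g η hμ)

theorem sum_expUpdate (η : ℝ) (hμ : ∀ i, 0 < μ i) : ∑ i, expUpdate η g μ i = 1 := by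
  simp only [expUpdate, ← Finset.sum_div]
  exact div_self (expPartition_pos g η hμ).ne'

theorem klSum_expUpdate (η : ℝ) (hμ : ∀ i, 0 < μ i) (hν : ν ∈ stdSimplex ℝ ι) :
    klSum ν (expUpdate η g μ) = klSum ν μ + η * (g ⬝ᵥ ν) + Real.log (expPartition η g μ) := by
  have hZ := expPartition_pos g η hμ
  have term_eq (i : ι) : ν i * Real.log (ν i / expUpdate η g μ i) =
      ν i * Real.log (ν i / μ i) + η * (g i * ν i) + ν i * Real.log (expPartition η g μ) := by
    rcases (hν.1 i).eq_or_lt with h | h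
    · simp only [← h, zero_mul, mul_zero, add_zero]
    · have ratio_eq : ν i / expUpdate η g μ i =
          ν i / μ i * Real.exp (η * g i) * expPartition η g μ := by
        have := (hμ i).ne'
        rw [expUpdate, Real.exp_neg]
        field_simp
      have ratio_pos := div_pos h (hμ i)
      rw [ratio_eq, Real.log_mul (by positivity) hZ.ne',
        Real.log_mul ratio_pos.ne' (Real.exp_ne_zero _), Real.log_exp]
      ring
  simp only [klSum, term_eq, Finset.sum_add_distrib, ← Finset.mul_sum, ← Finset.sum_mul, hν.2,
    one_mul]
  rfl

theorem exp_neg_le_quadratic {t : ℝ} (ht : 0 ≤ t) : Real.exp (-t) ≤ 1 - t + t ^ 2 / 2 := by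
  have quadratic_pos : 0 < 1 - t + t ^ 2 / 2 := by nlinarith [sq_nonneg (t - 1)]
  rw [Real.exp_neg, inv_le_iff_one_le_mul₀ (Real.exp_pos t)]
  calc 1 ≤ (1 - t + t ^ 2 / 2) * (1 + t + t ^ 2 / 2) := by nlinarith [sq_nonneg (t ^ 2)]
    _ ≤ (1 - t + t ^ 2 / 2) * Real.exp t := by
      gcongr
      exact Real.quadratic_le_exp_of_nonneg ht

theorem log_expPartition_le (hη : 0 ≤ η) (hg : ∀ i, 0 ≤ g i) (hμ : ∀ i, 0 < μ i)
    (hμ_sum : ∑ i, μ i = 1) :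
    Real.log (expPartition η g μ) ≤ -(η * (g ⬝ᵥ μ)) + η ^ 2 / 2 * ∑ i, μ i * g i ^ 2 := by
  have term_le (i : ι) : μ i * Real.exp (-(η * g i)) ≤
      μ i - η * (g i * μ i) + η ^ 2 / 2 * (μ i * g i ^ 2) :=
    calc μ i * Real.exp (-(η * g i)) ≤ μ i * (1 - η * g i + (η * g i) ^ 2 / 2) :=
          mul_le_mul_of_nonneg_left (exp_neg_le_quadratic (mul_nonneg hη (hg i))) (hμ i).le
      _ = _ := by ring
  have expPartition_le : expPartition η g μ ≤
      1 - η * (g ⬝ᵥ μ) + η ^ 2 / 2 * ∑ i, μ i * g i ^ 2 := by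
    refine (Finset.sum_le_sum fun i _ => term_le i).trans_eq ?_
    rw [Finset.sum_add_distrib, Finset.sum_sub_distrib, hμ_sum, ← Finset.mul_sum,
      ← Finset.mul_sum]
    rfl
  linarith [Real.log_le_sub_one_of_pos (expPartition_pos g η hμ)]

theorem dotProduct_sub_le_of_expUpdate (hη : 0 < η) (hg : ∀ i, 0 ≤ g i) (hμ : ∀ i, 0 < μ i)
    (hμ_sum : ∑ i, μ i = 1) (hν : ν ∈ stdSimplex ℝ ι) :
    g ⬝ᵥ (μ - ν) ≤
      1 / η * (klSum ν μ - klSum ν (expUpdate η g μ)) + η / 2 * ∑ i, μ i * g i ^ 2 := by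
  have log_le := log_expPartition_le g hη.le hg hμ hμ_sum
  rw [klSum_expUpdate g η hμ hν, dotProduct_sub]
  calc g ⬝ᵥ μ - g ⬝ᵥ ν
      = 1 / η * (klSum ν μ - (klSum ν μ + η * (g ⬝ᵥ ν) + -(η * (g ⬝ᵥ μ))
            + η ^ 2 / 2 * ∑ i, μ i * g i ^ 2)) + η / 2 * ∑ i, μ i * g i ^ 2 := by
        field_simp
        ring
    _ ≤ _ := by
        gcongr _ * (_ - ?_) + _
        linarith

end ExpUpdate

section MirrorStep

variable {S A : Type*} [Fintype S] [Fintype A] {η : ℝ}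

/-- The explicit form of the mirror descent update: a projected gradient step in the cube and
an exponential weights update in the simplex. -/
def explicitStep (η : ℝ) (g x : Vec S A) : Vec S A :=
  (cubeStep (η * Fintype.card S) g.1 x.1, expUpdate η g.2 x.2)

theorem one_div_mul_bregman (η : ℝ) (z x : Vec S A) : 1 / η * bregman z x =
    1 / (2 * (η * Fintype.card S)) * ∑ s, (z.1 s - x.1 s) ^ 2 + 1 / η * klSum z.2 x.2 := by
  rw [bregman, klSum]
  field_simp

variable [Nonempty S]

theorem eq_of_bregman_nonpos {z y : Vec S A} (hy : ∀ i, 0 < y.2 i) (hy_sum : ∑ i, y.2 i = 1)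
    (hz : z.2 ∈ stdSimplex ℝ (S × A)) (h : bregman z y ≤ 0) : z = y := by
  have klSum_nonneg : 0 ≤ klSum z.2 y.2 := klSum_nonneg hy hz.1 (hz.2.trans hy_sum.symm)
  have card_pos : 0 < 1 / (2 * (Fintype.card S : ℝ)) := by positivity
  have sum_nonneg : 0 ≤ ∑ s, (z.1 s - y.1 s) ^ 2 := Finset.sum_nonneg fun s _ => sq_nonneg _
  have bregman_eq : bregman z y =
    1 / (2 * (Fintype.card S : ℝ)) * ∑ s, (z.1 s - y.1 s) ^ 2 + klSum z.2 y.2 := rfl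
  have quadratic_nonneg := mul_nonneg card_pos.le sum_nonneg
  refine Prod.ext (funext fun s => ?_)
    (eq_of_klSum_nonpos hy hz.1 (hz.2.trans hy_sum.symm) (by linarith))
  have sum_eq_zero : ∑ s, (z.1 s - y.1 s) ^ 2 = 0 :=
    le_antisymm (nonpos_of_mul_nonpos_right (by linarith) card_pos) sum_nonneg
  have sq_eq_zero := (Finset.sum_eq_zero_iff_of_nonneg fun s _ => sq_nonneg _).1 sum_eq_zero s
    (Finset.mem_univ s)
  exact sub_eq_zero.1 (pow_eq_zero_iff two_ne_zero |>.1 sq_eq_zero)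

variable [Nonempty A]

theorem explicitStep_mem_decisionSet (η : ℝ) (g : Vec S A) {x : Vec S A} (hx : ∀ i, 0 < x.2 i) :
    explicitStep η g x ∈ decisionSet S A :=
  ⟨cubeStep_mem_Icc _ _ _, fun i => (expUpdate_pos g.2 η hx i).le, sum_expUpdate g.2 η hx⟩

theorem mdObjective_explicitStep_add_le (hη : 0 < η) (g : Vec S A) {x z : Vec S A}
    (hx : ∀ i, 0 < x.2 i) (hz : z ∈ decisionSet S A) :
    mdObjective η g x (explicitStep η g x) + 1 / η * bregman z (explicitStep η g x) ≤
      mdObjective η g x z := by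
  have cube_three_point := dotProduct_cubeStep_add_le (β := η * Fintype.card S) g.1 x.1
    (by positivity) hz.1
  have klSum_identity := klSum_expUpdate g.2 η hx hz.2
  have klSum_identity' := klSum_expUpdate g.2 η hx (explicitStep_mem_decisionSet η g hx).2
  have klSum_self := klSum_self (expUpdate_pos g.2 η hx)
  have simplex_three_point : g.2 ⬝ᵥ expUpdate η g.2 x.2 + 1 / η * klSum (expUpdate η g.2 x.2) x.2
      + 1 / η * klSum z.2 (expUpdate η g.2 x.2) = g.2 ⬝ᵥ z.2 + 1 / η * klSum z.2 x.2 := by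
    simp only [explicitStep] at klSum_identity'
    field_simp
    linarith
  simp only [mdObjective, one_div_mul_bregman, explicitStep]
  simp only [dotProduct] at cube_three_point simplex_three_point
  linarith

theorem mdStep_eq_explicitStep (hη : 0 < η) (g : Vec S A) {x : Decision S A}
    (hx : ∀ i, 0 < x.1.2 i) : (mdStep η g x).1 = explicitStep η g x.1 := by
  have mdStep_le : mdObjective η g x.1 (mdStep η g x).1 ≤
      mdObjective η g x.1 (explicitStep η g x.1) :=
    (exists_mdStep η g x).choose_spec ⟨_, explicitStep_mem_decisionSet η g hx⟩
  have bregman_nonpos : 1 / η * bregman (mdStep η g x).1 (explicitStep η g x.1) ≤ 0 := by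
    linarith [mdObjective_explicitStep_add_le hη g hx (mdStep η g x).2]
  exact eq_of_bregman_nonpos (expUpdate_pos g.2 η hx) (sum_expUpdate g.2 η hx)
    (mdStep η g x).2.2 (nonpos_of_mul_nonpos_right bregman_nonpos (by positivity))

theorem mdStep_regret_le (hη : 0 < η) {g : Vec S A} (hg : ∀ i, 0 ≤ g.2 i) {x : Decision S A}
    (hx : ∀ i, 0 < x.1.2 i) {z : Vec S A} (hz : z ∈ decisionSet S A) :
    g.1 ⬝ᵥ (x.1.1 - z.1) + g.2 ⬝ᵥ (x.1.2 - z.2) ≤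
      1 / η * (bregman z x.1 - bregman z (mdStep η g x).1)
        + η / 2 * (Fintype.card S * ∑ s, g.1 s ^ 2 + ∑ i, x.1.2 i * g.2 i ^ 2) := by
  have cube_regret := dotProduct_sub_le_of_cubeStep (β := η * Fintype.card S) g.1 x.1.1
    (by positivity) hz.1
  have simplex_regret := dotProduct_sub_le_of_expUpdate g.2 hη hg hx x.2.2.2 hz.2
  rw [mdStep_eq_explicitStep hη g hx, mul_sub, one_div_mul_bregman, one_div_mul_bregman]
  simp only [explicitStep]
  linarith

end MirrorStep

/-! ### The sampled gradient of one round -/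

/-- The samples of one round of mirror descent: an initial state, a pair visited by the current
`μ` with its successor, and a uniformly drawn pair that is probed, with its successor. -/
structure RoundSample (S A : Type*) where
  start : S
  visited : S × A
  next : S
  probe : S × A
  probeNext : S

instance {S A : Type*} [Fintype S] [Fintype A] : Fintype (RoundSample S A) :=
  Fintype.ofEquiv (S × (S × A) × S × (S × A) × S)
    { toFun := fun ω => ⟨ω.1, ω.2.1, ω.2.2.1, ω.2.2.2.1, ω.2.2.2.2⟩
      invFun := fun ω => (ω.start, ω.visited, ω.next, ω.probe, ω.probeNext) }

section Gradient

variable {S A : Type*} {γ : ℝ}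

/-- An unbiased sample of `1 / (1 - γ) - advantage γ M v i`, where `t` is a successor of `i`. -/
def sampledLoss (γ : ℝ) (M : MDP S A) (v : S → ℝ) (i : S × A) (t : S) : ℝ :=
  horizon γ - M.reward i.1 i.2 - horizon γ * (γ * v t - v i.1)

theorem sampledLoss_mem_Icc (h0 : 0 ≤ γ) (h1 : γ < 1) (M : MDP S A) {v : S → ℝ}
    (hv : ∀ s, v s ∈ Set.Icc (0 : ℝ) 1) (i : S × A) (t : S) :
    sampledLoss γ M v i t ∈ Set.Icc 0 (2 * horizon γ) := by
  obtain ⟨hvt_nonneg, hvt_le⟩ := hv t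
  obtain ⟨hvi_nonneg, hvi_le⟩ := hv i.1
  obtain ⟨hr_nonneg, hr_le⟩ := M.reward_mem i.1 i.2
  have horizon_nonneg : 0 ≤ horizon γ := zero_le_one.trans (one_le_horizon h0 h1)
  have drift_le : γ * v t - v i.1 ≤ γ := by nlinarith
  have le_drift : -1 ≤ γ * v t - v i.1 := by nlinarith
  have drift_mul_le := mul_le_mul_of_nonneg_left drift_le horizon_nonneg
  have le_drift_mul := mul_le_mul_of_nonneg_left le_drift horizon_nonneg
  have horizon_eq := one_sub_mul_horizon h1
  rw [sampledLoss]
  constructor <;> linarith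

variable [Fintype S]

theorem mean_sampledLoss (M : MDP S A) (v : S → ℝ) (i : S × A) :
    mean (M.trans i.1 i.2) (sampledLoss γ M v i) = horizon γ - advantage γ M v i := by
  change mean _ (fun t => horizon γ - M.reward i.1 i.2 - horizon γ * (γ * v t - v i.1)) = _
  rw [mean_sub, mean_const, mean_const_mul, mean_sub, mean_const_mul, mean_const, advantage,
    discountedDrift, sub_sub]

variable [Fintype A]

theorem mean_flowPMF (x : Decision S A) (f : S × A → ℝ) : mean (flowPMF x) f = x.1.2 ⬝ᵥ f := by
  refine Finset.sum_congr rfl fun i _ => ?_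
  change (flowPMF x i).toReal * f i = x.1.2 i * f i
  rw [flowPMF, PMF.ofFintype_apply, ENNReal.toReal_ofReal (x.2.2.1 i)]

/-- The gradient that mirror descent builds from the samples of one round. -/
def roundGradient (γ : ℝ) (M : MDP S A) (x : Vec S A) (ω : RoundSample S A) : Vec S A :=
  sampledGradient γ x ω.start ω.visited ω.next ω.probe
    (M.reward ω.probe.1 ω.probe.2) ω.probeNext

theorem roundGradient_fst_dotProduct (M : MDP S A) (x : Vec S A) (ω : RoundSample S A)
    (q : S → ℝ) : (roundGradient γ M x ω).1 ⬝ᵥ q =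
      q ω.start + horizon γ * (γ * q ω.next - q ω.visited.1) := by
  simp only [roundGradient, sampledGradient, add_dotProduct, smul_dotProduct, sub_dotProduct,
    single_one_dotProduct, smul_eq_mul, horizon]

open Classical in
theorem roundGradient_snd (M : MDP S A) (x : Vec S A) (ω : RoundSample S A) :
    (roundGradient γ M x ω).2 =
      Pi.single ω.probe (Fintype.card (S × A) * sampledLoss γ M x.1 ω.probe ω.probeNext) :=
  (Pi.single_smul _ _ _).symm

theorem roundGradient_snd_dotProduct (M : MDP S A) (x : Vec S A) (ω : RoundSample S A)
    (f : S × A → ℝ) : (roundGradient γ M x ω).2 ⬝ᵥ f =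
      Fintype.card (S × A) * sampledLoss γ M x.1 ω.probe ω.probeNext * f ω.probe := by
  classical
  rw [roundGradient_snd, single_dotProduct]

theorem roundGradient_snd_nonneg (h0 : 0 ≤ γ) (h1 : γ < 1) (M : MDP S A) {x : Vec S A}
    (hx : ∀ s, x.1 s ∈ Set.Icc (0 : ℝ) 1) (ω : RoundSample S A) (i : S × A) :
    0 ≤ (roundGradient γ M x ω).2 i := by
  classical
  rw [roundGradient_snd]
  have single_nonneg : (0 : S × A → ℝ) ≤ Pi.single ω.probe
      (Fintype.card (S × A) * sampledLoss γ M x.1 ω.probe ω.probeNext) :=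
    Pi.single_nonneg.2 (mul_nonneg (Nat.cast_nonneg _) (sampledLoss_mem_Icc h0 h1 M hx _ _).1)
  exact single_nonneg i

theorem sum_abs_roundGradient_fst_le (h0 : 0 ≤ γ) (h1 : γ < 1) (M : MDP S A) (x : Vec S A)
    (ω : RoundSample S A) : ∑ s, |(roundGradient γ M x ω).1 s| ≤ 2 * horizon γ := by
  classical
  have single_nonneg (s t : S) : 0 ≤ (Pi.single s 1 : S → ℝ) t :=
    (Pi.single_nonneg.2 zero_le_one : (0 : S → ℝ) ≤ Pi.single s 1) t
  have horizon_nonneg : 0 ≤ horizon γ := zero_le_one.trans (one_le_horizon h0 h1)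
  have term_le (s : S) : |(roundGradient γ M x ω).1 s| ≤ (Pi.single ω.start 1 : S → ℝ) s +
      horizon γ * (γ * (Pi.single ω.next 1 : S → ℝ) s + (Pi.single ω.visited.1 1 : S → ℝ) s) := by
    have fst_eq : (roundGradient γ M x ω).1 s = (Pi.single ω.start 1 : S → ℝ) s +
        horizon γ * (γ * (Pi.single ω.next 1 : S → ℝ) s
          - (Pi.single ω.visited.1 1 : S → ℝ) s) := rfl
    rw [fst_eq, mul_sub, mul_add]
    have start_nonneg := single_nonneg ω.start s
    have next_nonneg := mul_nonneg horizon_nonneg (mul_nonneg h0 (single_nonneg ω.next s))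
    have visited_nonneg := mul_nonneg horizon_nonneg (single_nonneg ω.visited.1 s)
    exact abs_le.2 ⟨by linarith, by linarith⟩
  refine (Finset.sum_le_sum fun s _ => term_le s).trans_eq ?_
  simp only [Finset.sum_add_distrib, ← Finset.mul_sum, Finset.sum_pi_single', Finset.mem_univ,
    if_true]
  linarith [one_sub_mul_horizon h1]

variable [Nonempty S] [Nonempty A]

/-- The law of the samples that mirror descent draws in one round from the decision `x`. -/
def roundLaw (M : MDP S A) (x : Decision S A) : PMF (RoundSample S A) :=
  M.init.bind fun s₀ => (flowPMF x).bind fun i => (M.trans i.1 i.2).bind fun s' =>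
    (PMF.uniformOfFintype (S × A)).bind fun j => (M.trans j.1 j.2).bind fun t' =>
      PMF.pure ⟨s₀, i, s', j, t'⟩

theorem mean_roundLaw (M : MDP S A) (x : Decision S A) (f : RoundSample S A → ℝ) :
    mean (roundLaw M x) f =
      mean M.init fun s₀ => mean (flowPMF x) fun i => mean (M.trans i.1 i.2) fun s' =>
        mean (PMF.uniformOfFintype (S × A)) fun j => mean (M.trans j.1 j.2) fun t' =>
          f ⟨s₀, i, s', j, t'⟩ := by
  simp only [roundLaw, mean_bind, mean_pure]

theorem mean_roundLaw_probe (M : MDP S A) (x : Decision S A) (f : S × A → ℝ) :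
    mean (roundLaw M x) (fun ω => f ω.probe) = 1 / (Fintype.card (S × A) : ℝ) * ∑ i, f i := by
  simp only [mean_roundLaw, mean_const, mean_uniform]

/-- The expectation of the sampled gradient. -/
def meanGradient (γ : ℝ) (M : MDP S A) (x : Decision S A) : Vec S A :=
  (fun s => mean (roundLaw M x) fun ω => (roundGradient γ M x.1 ω).1 s,
    fun i => mean (roundLaw M x) fun ω => (roundGradient γ M x.1 ω).2 i)

theorem meanGradient_fst_dotProduct (M : MDP S A) (x : Decision S A) (q : S → ℝ) :
    (meanGradient γ M x).1 ⬝ᵥ q =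
      initMean M q + horizon γ * (x.1.2 ⬝ᵥ discountedDrift γ M q) := by
  have mean_drift : mean (flowPMF x) (discountedDrift γ M q) =
      γ * mean (flowPMF x) (fun i => mean (M.trans i.1 i.2) q) -
        mean (flowPMF x) fun i => q i.1 := by
    rw [← mean_const_mul, ← mean_sub]
    rfl
  rw [meanGradient, ← mean_dotProduct, mean_roundLaw, ← mean_flowPMF, mean_drift]
  simp only [roundGradient_fst_dotProduct, mean_add, mean_const_mul, mean_sub, mean_const]
  rfl

theorem meanGradient_snd (M : MDP S A) (x : Decision S A) :
    (meanGradient γ M x).2 = fun i => horizon γ - advantage γ M x.1.1 i := by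
  have card_ne_zero : (Fintype.card (S × A) : ℝ) ≠ 0 := Nat.cast_ne_zero.2 Fintype.card_ne_zero
  refine dotProduct_eq _ _ fun f => ?_
  have mean_probe (i : S × A) : mean (M.trans i.1 i.2)
      (fun t => Fintype.card (S × A) * sampledLoss γ M x.1.1 i t * f i) =
        Fintype.card (S × A) * ((horizon γ - advantage γ M x.1.1 i) * f i) := by
    simp only [← mean_sampledLoss, mul_comm _ (f i), mul_left_comm (f i), mean_const_mul]
  rw [meanGradient, ← mean_dotProduct, mean_roundLaw]
  simp only [roundGradient_snd_dotProduct, mean_probe, mean_const, mean_uniform]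
  rw [← Finset.mul_sum, ← mul_assoc, one_div_mul_cancel card_ne_zero, one_mul]
  rfl

theorem meanGradient_dotProduct_sub (M : MDP S A) (x : Decision S A) {z : Vec S A}
    (hz : ∑ i, z.2 i = 1) :
    (meanGradient γ M x).1 ⬝ᵥ (x.1.1 - z.1) + (meanGradient γ M x).2 ⬝ᵥ (x.1.2 - z.2) =
      lagrangian γ M x.1.1 z.2 - lagrangian γ M z.1 x.1.2 := by
  have advantage_eq (v : S → ℝ) (μ : S × A → ℝ) : μ ⬝ᵥ advantage γ M v =
      (μ ⬝ᵥ fun i => M.reward i.1 i.2) + horizon γ * (μ ⬝ᵥ discountedDrift γ M v) := by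
    rw [← smul_eq_mul, ← dotProduct_smul, ← dotProduct_add]
    rfl
  have loss_eq {μ : S × A → ℝ} (hμ : ∑ i, μ i = 1) :
      (fun i => horizon γ - advantage γ M x.1.1 i) ⬝ᵥ μ =
        horizon γ - μ ⬝ᵥ advantage γ M x.1.1 := by
    rw [dotProduct_comm]
    simp only [dotProduct, mul_sub, Finset.sum_sub_distrib, ← Finset.sum_mul, hμ, one_mul]
  rw [dotProduct_sub, dotProduct_sub, meanGradient_fst_dotProduct, meanGradient_fst_dotProduct,
    meanGradient_snd, loss_eq x.2.2.2, loss_eq hz,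
    lagrangian, lagrangian, advantage_eq z.1]
  rw [advantage_eq x.1.1 x.1.2]
  ring

theorem meanGradient_snd_dotProduct_mem_Icc (h0 : 0 ≤ γ) (h1 : γ < 1) (M : MDP S A)
    (x : Decision S A) {ν : S × A → ℝ} (hν : ν ∈ stdSimplex ℝ (S × A)) :
    (meanGradient γ M x).2 ⬝ᵥ ν ∈ Set.Icc 0 (2 * horizon γ) := by
  rw [dotProduct_comm]
  refine dotProduct_mem_Icc hν fun i => ?_
  rw [meanGradient_snd]
  beta_reduce
  rw [← mean_sampledLoss]
  exact mean_mem_Icc _ (sampledLoss_mem_Icc h0 h1 M x.2.1 i)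

end Gradient

/-! ### The regret of one round and its exponential moments -/

section Round

variable {S A : Type*} [Fintype S] [Fintype A] {γ η : ℝ}

/-- The part of the regret of one round against `ν` that is due to the sampled gradient in the
simplex: the quadratic term of the mirror step minus the linear term. -/
def simplexIncrement (γ η : ℝ) (M : MDP S A) (ν : S × A → ℝ) (x : Decision S A)
    (ω : RoundSample S A) : ℝ :=
  η / 2 * ∑ i, x.1.2 i * (roundGradient γ M x.1 ω).2 i ^ 2
    - (roundGradient γ M x.1 ω).2 ⬝ᵥ (x.1.2 - ν)

section SimplexIncrement

variable (M : MDP S A) {ν : S × A → ℝ} (x : Decision S A)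

theorem simplexIncrement_eq (ω : RoundSample S A) :
    simplexIncrement γ η M ν x ω =
      let y := Fintype.card (S × A) * sampledLoss γ M x.1.1 ω.probe ω.probeNext
      η / 2 * (x.1.2 ω.probe * y ^ 2) - y * (x.1.2 ω.probe - ν ω.probe) := by
  classical
  rw [simplexIncrement, roundGradient_snd_dotProduct, roundGradient_snd]
  simp only [Pi.single_apply, ite_pow, mul_ite, zero_pow two_ne_zero, mul_zero,
    Finset.sum_ite_eq', Finset.mem_univ, if_true, Pi.sub_apply]

theorem card_mul_sampledLoss_mem_Icc (h0 : 0 ≤ γ) (h1 : γ < 1) (i : S × A) (t : S) :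
    Fintype.card (S × A) * sampledLoss γ M x.1.1 i t ∈
      Set.Icc 0 (2 * (Fintype.card (S × A) * horizon γ)) := by
  obtain ⟨loss_nonneg, loss_le⟩ := sampledLoss_mem_Icc h0 h1 M x.2.1 i t
  have := mul_le_mul_of_nonneg_left loss_le (Nat.cast_nonneg (α := ℝ) (Fintype.card (S × A)))
  exact ⟨by positivity, by linarith⟩

theorem simplexIncrement_mem_Icc (h0 : 0 ≤ γ) (h1 : γ < 1) (hη : 0 ≤ η)
    (hηKH : η * (Fintype.card (S × A) * horizon γ) ≤ 1) (hν : ν ∈ stdSimplex ℝ (S × A))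
    (ω : RoundSample S A) :
    simplexIncrement γ η M ν x ω ∈
      Set.Icc (-(2 * (Fintype.card (S × A) * horizon γ) * x.1.2 ω.probe))
        (2 * (Fintype.card (S × A) * horizon γ) * ν ω.probe) := by
  obtain ⟨y_nonneg, y_le⟩ := card_mul_sampledLoss_mem_Icc M x h0 h1 ω.probe ω.probeNext
  rw [simplexIncrement_eq]
  set y := Fintype.card (S × A) * sampledLoss γ M x.1.1 ω.probe ω.probeNext
  have hμ := x.2.2.1 ω.probe
  have half_step_le_one : η / 2 * y ≤ 1 := by
    linarith [mul_le_mul_of_nonneg_left y_le hη]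
  have quadratic_le : η / 2 * (x.1.2 ω.probe * y ^ 2) ≤ y * x.1.2 ω.probe := by
    calc _ = η / 2 * y * (y * x.1.2 ω.probe) := by ring
      _ ≤ y * x.1.2 ω.probe := mul_le_of_le_one_left (mul_nonneg y_nonneg hμ) half_step_le_one
  have quadratic_nonneg : 0 ≤ η / 2 * (x.1.2 ω.probe * y ^ 2) := by positivity
  have ν_nonneg := mul_nonneg y_nonneg (hν.1 ω.probe)
  have mul_μ_le := mul_le_mul_of_nonneg_right y_le hμ
  have mul_ν_le := mul_le_mul_of_nonneg_right y_le (hν.1 ω.probe)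
  constructor <;> linarith

end SimplexIncrement

variable [Nonempty S] [Nonempty A]

/-- The deviation of the sampled gradient of one round from its expectation. -/
def gradientNoise (γ : ℝ) (M : MDP S A) (x : Decision S A) (ω : RoundSample S A) : Vec S A :=
  meanGradient γ M x - roundGradient γ M x.1 ω

/-- The random part of the regret of one round against `ν`, with the noise in the cube measured
against a ghost point `u` that does not depend on the comparator, together with the quadratic
terms that the two mirror steps incur. -/
def roundIncrement (γ η : ℝ) (M : MDP S A) (ν : S × A → ℝ) (x : Decision S A) (u : S → ℝ)
    (ω : RoundSample S A) : ℝ :=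
  (gradientNoise γ M x ω).1 ⬝ᵥ (x.1.1 - u) + (gradientNoise γ M x ω).2 ⬝ᵥ (x.1.2 - ν)
    + η / 2 * (Fintype.card S *
        (∑ s, (roundGradient γ M x.1 ω).1 s ^ 2 + ∑ s, (gradientNoise γ M x ω).1 s ^ 2)
      + ∑ i, x.1.2 i * (roundGradient γ M x.1 ω).2 i ^ 2)

/-- The ghost update: projected gradient descent in the cube, driven by the noise alone. -/
def ghostStep (γ η : ℝ) (M : MDP S A) (x : Decision S A) (u : S → ℝ) (ω : RoundSample S A) :
    S → ℝ :=
  cubeStep (η * Fintype.card S) (gradientNoise γ M x ω).1 u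

/-- The potential of a decision `x` and a ghost point `u` relative to a comparator `z`. -/
def potential (η : ℝ) (z x : Vec S A) (u : S → ℝ) : ℝ :=
  1 / η * bregman z x + 1 / (2 * (η * Fintype.card S)) * ∑ s, (z.1 s - u s) ^ 2

theorem regret_round_le (h0 : 0 ≤ γ) (h1 : γ < 1) (hη : 0 < η) (M : MDP S A) {x : Decision S A}
    (hx : ∀ i, 0 < x.1.2 i) (u : S → ℝ) (ω : RoundSample S A) {z : Vec S A}
    (hz : z ∈ decisionSet S A) :
    lagrangian γ M x.1.1 z.2 - lagrangian γ M z.1 x.1.2 ≤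
      roundIncrement γ η M z.2 x u ω + potential η z x.1 u
        - potential η z (mdStep η (roundGradient γ M x.1 ω) x).1 (ghostStep γ η M x u ω) := by
  have regret_le := mdStep_regret_le hη (roundGradient_snd_nonneg h0 h1 M x.2.1 ω) hx hz
  have ghost_regret_le := dotProduct_sub_le_of_cubeStep (β := η * Fintype.card S)
    (gradientNoise γ M x ω).1 u (by positivity) hz.1
  have gradient_eq : meanGradient γ M x = roundGradient γ M x.1 ω + gradientNoise γ M x ω :=
    (add_sub_cancel _ _).symm
  have noise_split : (gradientNoise γ M x ω).1 ⬝ᵥ (x.1.1 - z.1) =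
      (gradientNoise γ M x ω).1 ⬝ᵥ (x.1.1 - u) + (gradientNoise γ M x ω).1 ⬝ᵥ (u - z.1) := by
    rw [← dotProduct_add, sub_add_sub_cancel]
  rw [← meanGradient_dotProduct_sub M x hz.2.2, gradient_eq, Prod.fst_add, Prod.snd_add,
    add_dotProduct, add_dotProduct, noise_split, roundIncrement, potential, potential, ghostStep]
  linarith

theorem sum_abs_gradientNoise_fst_le (h0 : 0 ≤ γ) (h1 : γ < 1) (M : MDP S A)
    (x : Decision S A) (ω : RoundSample S A) :
    ∑ s, |(gradientNoise γ M x ω).1 s| ≤ 4 * horizon γ := by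
  have sum_abs_mean_le : ∑ s, |(meanGradient γ M x).1 s| ≤ 2 * horizon γ := by
    calc ∑ s, |(meanGradient γ M x).1 s|
        ≤ ∑ s, mean (roundLaw M x) fun ω => |(roundGradient γ M x.1 ω).1 s| :=
          Finset.sum_le_sum fun s _ => abs_mean_le_mean_abs _ _
      _ = mean (roundLaw M x) fun ω => ∑ s, |(roundGradient γ M x.1 ω).1 s| :=
          (mean_sum _ _).symm
      _ ≤ 2 * horizon γ := (mean_mono _ fun ω =>
          sum_abs_roundGradient_fst_le h0 h1 M x.1 ω).trans_eq (mean_const _ _)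
  calc ∑ s, |(gradientNoise γ M x ω).1 s|
      ≤ ∑ s, (|(meanGradient γ M x).1 s| + |(roundGradient γ M x.1 ω).1 s|) :=
        Finset.sum_le_sum fun s _ => abs_sub _ _
    _ ≤ 4 * horizon γ := by
        rw [Finset.sum_add_distrib]
        linarith [sum_abs_roundGradient_fst_le h0 h1 M x.1 ω]

/-- The part of `roundIncrement` that is linear in the cube component of the noise, with the
expected gradient in the simplex. -/
def linearIncrement (γ : ℝ) (M : MDP S A) (ν : S × A → ℝ) (x : Decision S A) (u : S → ℝ)
    (ω : RoundSample S A) : ℝ :=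
  (gradientNoise γ M x ω).1 ⬝ᵥ (x.1.1 - u) + (meanGradient γ M x).2 ⬝ᵥ (x.1.2 - ν)

theorem roundIncrement_le (h0 : 0 ≤ γ) (h1 : γ < 1) (hη : 0 ≤ η) (M : MDP S A)
    (ν : S × A → ℝ) (x : Decision S A) (u : S → ℝ) (ω : RoundSample S A) :
    roundIncrement γ η M ν x u ω ≤ linearIncrement γ M ν x u ω + simplexIncrement γ η M ν x ω
      + 10 * (η * (Fintype.card (S × A) * horizon γ ^ 2)) := by
  have gradient_sq_le := sum_sq_le_of_sum_abs_le (sum_abs_roundGradient_fst_le h0 h1 M x.1 ω)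
  have noise_sq_le := sum_sq_le_of_sum_abs_le (sum_abs_gradientNoise_fst_le h0 h1 M x ω)
  have card_le : (Fintype.card S : ℝ) ≤ Fintype.card (S × A) :=
    Nat.cast_le.2 (Fintype.card_le_of_surjective _ Prod.fst_surjective)
  have quadratic_le : η / 2 * (Fintype.card S * (∑ s, (roundGradient γ M x.1 ω).1 s ^ 2
      + ∑ s, (gradientNoise γ M x ω).1 s ^ 2)) ≤
        10 * (η * (Fintype.card (S × A) * horizon γ ^ 2)) := by
    calc _ ≤ η / 2 * (Fintype.card (S × A) * ((2 * horizon γ) ^ 2 + (4 * horizon γ) ^ 2)) := by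
          gcongr
      _ = _ := by ring
  have noise_snd : (gradientNoise γ M x ω).2 =
      (meanGradient γ M x).2 - (roundGradient γ M x.1 ω).2 := rfl
  rw [roundIncrement, linearIncrement, simplexIncrement, noise_snd, sub_dotProduct]
  linarith

variable (M : MDP S A) {ν : S × A → ℝ} (x : Decision S A)

theorem abs_linearIncrement_le (h0 : 0 ≤ γ) (h1 : γ < 1) (hν : ν ∈ stdSimplex ℝ (S × A)) {u : S → ℝ}
    (hu : ∀ s, u s ∈ Set.Icc (0 : ℝ) 1) (ω : RoundSample S A) :
    |linearIncrement γ M ν x u ω| ≤ 6 * horizon γ := by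
  have abs_sub_le_one (s : S) : |(x.1.1 - u) s| ≤ 1 := by
    have := Real.dist_le_of_mem_Icc (x.2.1 s) (hu s)
    rwa [Real.dist_eq, sub_zero] at this
  have cube_le := (abs_dotProduct_le _ abs_sub_le_one).trans
    (mul_le_mul_of_nonneg_right (sum_abs_gradientNoise_fst_le h0 h1 M x ω) zero_le_one)
  have simplex_le := Real.dist_le_of_mem_Icc
    (meanGradient_snd_dotProduct_mem_Icc h0 h1 M x x.2.2)
    (meanGradient_snd_dotProduct_mem_Icc h0 h1 M x hν)
  rw [Real.dist_eq] at simplex_le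
  rw [linearIncrement, dotProduct_sub (meanGradient γ M x).2]
  linarith [abs_add_le ((gradientNoise γ M x ω).1 ⬝ᵥ (x.1.1 - u))
    ((meanGradient γ M x).2 ⬝ᵥ x.1.2 - (meanGradient γ M x).2 ⬝ᵥ ν)]

theorem mean_linearIncrement (u : S → ℝ) :
    mean (roundLaw M x) (linearIncrement γ M ν x u) =
      (meanGradient γ M x).2 ⬝ᵥ (x.1.2 - ν) := by
  have mean_noise : (fun s => mean (roundLaw M x) fun ω => (gradientNoise γ M x ω).1 s) = 0 := by
    funext s
    change mean _ (fun ω => (meanGradient γ M x).1 s - (roundGradient γ M x.1 ω).1 s) = 0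
    rw [mean_sub, mean_const]
    exact sub_self _
  unfold linearIncrement
  rw [mean_add, mean_const, mean_dotProduct, mean_noise, zero_dotProduct, zero_add]

theorem mean_sq_simplexIncrement_le (h0 : 0 ≤ γ) (h1 : γ < 1) (hη : 0 ≤ η)
    (hηKH : η * (Fintype.card (S × A) * horizon γ) ≤ 1) (hν : ν ∈ stdSimplex ℝ (S × A)) :
    mean (roundLaw M x) (fun ω => simplexIncrement γ η M ν x ω ^ 2) ≤
      8 * (Fintype.card (S × A) * horizon γ ^ 2) := by
  have card_pos : 0 < (Fintype.card (S × A) : ℝ) := Nat.cast_pos.2 Fintype.card_pos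
  have sq_le (ω : RoundSample S A) : simplexIncrement γ η M ν x ω ^ 2 ≤
      (2 * (Fintype.card (S × A) * horizon γ)) ^ 2 * (x.1.2 ω.probe + ν ω.probe) := by
    obtain ⟨le_increment, increment_le⟩ := simplexIncrement_mem_Icc M x h0 h1 hη hηKH hν ω
    obtain ⟨μ_nonneg, μ_le⟩ := mem_Icc_of_mem_stdSimplex x.2.2 ω.probe
    obtain ⟨ν_nonneg, ν_le⟩ := mem_Icc_of_mem_stdSimplex hν ω.probe
    have scale_nonneg : 0 ≤ 2 * (Fintype.card (S × A) * horizon γ) := by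
      linarith [mul_nonneg card_pos.le (zero_le_one.trans (one_le_horizon h0 h1))]
    rcases le_total 0 (simplexIncrement γ η M ν x ω) with h | h
    · calc _ ≤ (2 * (Fintype.card (S × A) * horizon γ) * ν ω.probe) ^ 2 := by gcongr
        _ = (2 * (Fintype.card (S × A) * horizon γ)) ^ 2 * (ν ω.probe * ν ω.probe) := by ring
        _ ≤ _ := by gcongr; linarith [mul_le_of_le_one_left ν_nonneg ν_le]
    · calc _ ≤ (2 * (Fintype.card (S × A) * horizon γ) * x.1.2 ω.probe) ^ 2 :=
          sq_le_sq' le_increment (h.trans (mul_nonneg scale_nonneg μ_nonneg))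
        _ = (2 * (Fintype.card (S × A) * horizon γ)) ^ 2 * (x.1.2 ω.probe * x.1.2 ω.probe) := by
          ring
        _ ≤ _ := by gcongr; linarith [mul_le_of_le_one_left μ_nonneg μ_le]
  calc mean (roundLaw M x) (fun ω => simplexIncrement γ η M ν x ω ^ 2)
      ≤ mean (roundLaw M x) fun ω =>
          (2 * (Fintype.card (S × A) * horizon γ)) ^ 2 * (x.1.2 ω.probe + ν ω.probe) :=
        mean_mono _ sq_le
    _ = (2 * (Fintype.card (S × A) * horizon γ)) ^ 2 * (1 / Fintype.card (S × A) * (1 + 1)) := by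
        rw [mean_const_mul, mean_roundLaw_probe M x fun i => x.1.2 i + ν i,
          Finset.sum_add_distrib, x.2.2.2, hν.2]
    _ = 8 * (Fintype.card (S × A) * horizon γ ^ 2) := by
        field_simp
        ring

theorem mean_simplexIncrement_le (h0 : 0 ≤ γ) (h1 : γ < 1) (hη : 0 ≤ η) :
    mean (roundLaw M x) (simplexIncrement γ η M ν x) ≤
      2 * (η * (Fintype.card (S × A) * horizon γ ^ 2))
        - (meanGradient γ M x).2 ⬝ᵥ (x.1.2 - ν) := by
  have : 0 < (Fintype.card (S × A) : ℝ) := Nat.cast_pos.2 Fintype.card_pos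
  have increment_le (ω : RoundSample S A) : simplexIncrement γ η M ν x ω ≤
      η / 2 * (2 * (Fintype.card (S × A) * horizon γ)) ^ 2 * x.1.2 ω.probe
        - (roundGradient γ M x.1 ω).2 ⬝ᵥ (x.1.2 - ν) := by
    obtain ⟨y_nonneg, y_le⟩ := card_mul_sampledLoss_mem_Icc M x h0 h1 ω.probe ω.probeNext
    have hμ := x.2.2.1 ω.probe
    have quadratic_le := mul_le_mul_of_nonneg_left (pow_le_pow_left₀ y_nonneg y_le 2)
      (mul_nonneg (div_nonneg hη zero_le_two) hμ)
    rw [simplexIncrement_eq, roundGradient_snd_dotProduct]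
    simp only [Pi.sub_apply]
    linarith
  calc mean (roundLaw M x) (simplexIncrement γ η M ν x)
      ≤ mean (roundLaw M x) fun ω =>
          η / 2 * (2 * (Fintype.card (S × A) * horizon γ)) ^ 2 * x.1.2 ω.probe
            - (roundGradient γ M x.1 ω).2 ⬝ᵥ (x.1.2 - ν) := mean_mono _ increment_le
    _ = η / 2 * (2 * (Fintype.card (S × A) * horizon γ)) ^ 2 * (1 / Fintype.card (S × A) * 1)
          - (meanGradient γ M x).2 ⬝ᵥ (x.1.2 - ν) := by
        rw [mean_sub, mean_const_mul, mean_roundLaw_probe, x.2.2.2, mean_dotProduct]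
        rfl
    _ = _ := by field_simp

theorem horizon_le_card_mul_horizon (h0 : 0 ≤ γ) (h1 : γ < 1) :
    horizon γ ≤ Fintype.card (S × A) * horizon γ :=
  le_mul_of_one_le_left (zero_le_one.trans (one_le_horizon h0 h1))
    (Nat.one_le_cast.2 Fintype.card_pos)

theorem abs_linearIncrement_add_simplexIncrement_le (h0 : 0 ≤ γ) (h1 : γ < 1) (hη : 0 ≤ η)
    (hηKH : η * (Fintype.card (S × A) * horizon γ) ≤ 1) (hν : ν ∈ stdSimplex ℝ (S × A))
    {u : S → ℝ} (hu : ∀ s, u s ∈ Set.Icc (0 : ℝ) 1) (ω : RoundSample S A) :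
    |linearIncrement γ M ν x u ω + simplexIncrement γ η M ν x ω| ≤
      8 * (Fintype.card (S × A) * horizon γ) := by
  have horizon_le := horizon_le_card_mul_horizon (S := S) (A := A) h0 h1
  have horizon_nonneg : 0 ≤ horizon γ := zero_le_one.trans (one_le_horizon h0 h1)
  have scale_nonneg : 0 ≤ 2 * (Fintype.card (S × A) * horizon γ) := by positivity
  obtain ⟨le_increment, increment_le⟩ := simplexIncrement_mem_Icc M x h0 h1 hη hηKH hν ω
  have mul_μ_le := mul_le_of_le_one_right scale_nonneg
    (mem_Icc_of_mem_stdSimplex x.2.2 ω.probe).2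
  have mul_ν_le := mul_le_of_le_one_right scale_nonneg (mem_Icc_of_mem_stdSimplex hν ω.probe).2
  have linear_le := abs_le.1 (abs_linearIncrement_le M x h0 h1 hν hu ω)
  exact abs_le.2 ⟨by linarith, by linarith⟩

theorem mean_sq_linearIncrement_add_simplexIncrement_le (h0 : 0 ≤ γ) (h1 : γ < 1) (hη : 0 ≤ η)
    (hηKH : η * (Fintype.card (S × A) * horizon γ) ≤ 1) (hν : ν ∈ stdSimplex ℝ (S × A))
    {u : S → ℝ} (hu : ∀ s, u s ∈ Set.Icc (0 : ℝ) 1) :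
    mean (roundLaw M x)
        (fun ω => (linearIncrement γ M ν x u ω + simplexIncrement γ η M ν x ω) ^ 2) ≤
      88 * (Fintype.card (S × A) * horizon γ ^ 2) := by
  have one_le_card : 1 ≤ (Fintype.card (S × A) : ℝ) := Nat.one_le_cast.2 Fintype.card_pos
  have sq_le (ω : RoundSample S A) :
      (linearIncrement γ M ν x u ω + simplexIncrement γ η M ν x ω) ^ 2 ≤
        2 * (6 * horizon γ) ^ 2 + 2 * simplexIncrement γ η M ν x ω ^ 2 := by
    linarith [add_sq_le (a := linearIncrement γ M ν x u ω) (b := simplexIncrement γ η M ν x ω),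
      sq_le_sq.2 ((abs_linearIncrement_le M x h0 h1 hν hu ω).trans (le_abs_self _))]
  refine (mean_mono _ sq_le).trans ?_
  rw [mean_add, mean_const, mean_const_mul]
  linarith [mean_sq_simplexIncrement_le M x h0 h1 hη hηKH hν,
    le_mul_of_one_le_left (sq_nonneg (horizon γ)) one_le_card]

theorem mean_exp_roundIncrement_le (h0 : 0 ≤ γ) (h1 : γ < 1) (hη : 0 ≤ η)
    (hηKH : η * (Fintype.card (S × A) * horizon γ) ≤ 1) (hν : ν ∈ stdSimplex ℝ (S × A))
    {u : S → ℝ} (hu : ∀ s, u s ∈ Set.Icc (0 : ℝ) 1) {l : ℝ} (hl : 0 ≤ l)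
    (hlKH : l * (8 * (Fintype.card (S × A) * horizon γ)) ≤ 1) :
    mean (roundLaw M x) (fun ω => Real.exp (l * roundIncrement γ η M ν x u ω)) ≤
      Real.exp (l * (12 * (η * (Fintype.card (S × A) * horizon γ ^ 2)))
        + l ^ 2 * (88 * (Fintype.card (S × A) * horizon γ ^ 2))) := by
  set c := η * (Fintype.card (S × A) * horizon γ ^ 2)
  set Y : RoundSample S A → ℝ := fun ω =>
    linearIncrement γ M ν x u ω + simplexIncrement γ η M ν x ω with hY
  have abs_mul_le_one (ω : RoundSample S A) : |l * Y ω| ≤ 1 := by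
    rw [abs_mul, abs_of_nonneg hl]
    exact (mul_le_mul_of_nonneg_left
      (abs_linearIncrement_add_simplexIncrement_le M x h0 h1 hη hηKH hν hu ω) hl).trans hlKH
  have mean_le : mean (roundLaw M x) Y ≤ 2 * c := by
    rw [hY, mean_add]
    linarith [mean_linearIncrement (γ := γ) (ν := ν) M x u,
      mean_simplexIncrement_le (ν := ν) M x h0 h1 hη]
  calc mean (roundLaw M x) (fun ω => Real.exp (l * roundIncrement γ η M ν x u ω))
      ≤ mean (roundLaw M x) fun ω => Real.exp (l * (10 * c)) * Real.exp (l * Y ω) := by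
        refine mean_mono _ fun ω => ?_
        rw [← Real.exp_add, Real.exp_le_exp, ← mul_add, add_comm (10 * c)]
        exact mul_le_mul_of_nonneg_left (roundIncrement_le h0 h1 hη M ν x u ω) hl
    _ ≤ Real.exp (l * (10 * c)) * Real.exp (l * (2 * c)
          + l ^ 2 * (88 * (Fintype.card (S × A) * horizon γ ^ 2))) := by
        rw [mean_const_mul]
        exact mul_le_mul_of_nonneg_left (mean_exp_le _ hl abs_mul_le_one mean_le
          (mean_sq_linearIncrement_add_simplexIncrement_le M x h0 h1 hη hηKH hν hu))
          (Real.exp_pos _).le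
    _ = _ := by
        rw [← Real.exp_add]
        ring_nf

end Round

/-! ### The law of the learned policy -/

section OutputLaw

variable {S A α : Type*} (M : MDP S A)

/-- The law of the output of a program that is run on the MDP `M`. -/
def outputLaw (P : GenProg S A α) : PMF α :=
  (P.exec M).map Prod.fst

theorem map_fst_map_succ (p : PMF (α × ℕ)) :
    (p.map fun o => (o.1, o.2 + 1)).map Prod.fst = p.map Prod.fst :=
  PMF.map_comp _ _ _

theorem outputLaw_done (a : α) : outputLaw M (.done a) = PMF.pure a :=
  PMF.pure_map _ _

theorem outputLaw_coin (q : PMF (S × A)) (next : S × A → GenProg S A α) :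
    outputLaw M (.coin q next) = q.bind fun i => outputLaw M (next i) :=
  PMF.map_bind _ _ _

theorem outputLaw_sampleInit (next : S → GenProg S A α) :
    outputLaw M (.sampleInit next) = M.init.bind fun s => outputLaw M (next s) := by
  simp only [outputLaw, GenProg.exec, PMF.map_bind, map_fst_map_succ]

theorem outputLaw_sampleTrans (i : S × A) (next : S → GenProg S A α) :
    outputLaw M (.sampleTrans i next) =
      (M.trans i.1 i.2).bind fun s => outputLaw M (next s) := by
  simp only [outputLaw, GenProg.exec, PMF.map_bind, map_fst_map_succ]

theorem outputLaw_queryReward (i : S × A) (next : ℝ → GenProg S A α) :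
    outputLaw M (.queryReward i next) = outputLaw M (next (M.reward i.1 i.2)) :=
  map_fst_map_succ _

variable [Fintype S] [Fintype A] [Nonempty S] [Nonempty A]

theorem outputLaw_mdLoop_succ (γ η : ℝ) (N m : ℕ) (x : Decision S A) (acc : Vec S A) :
    outputLaw M (mdLoop γ η N (m + 1) x acc) = (roundLaw M x).bind fun ω =>
      outputLaw M (mdLoop γ η N m (mdStep η (roundGradient γ M x.1 ω) x) (acc + x.1)) := by
  simp only [mdLoop, roundLaw, outputLaw_sampleInit, outputLaw_coin, outputLaw_sampleTrans,
    outputLaw_queryReward, PMF.bind_bind, PMF.pure_bind]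
  rfl

theorem calls_mdLoop (γ η : ℝ) (N m : ℕ) (x : Decision S A) (acc : Vec S A) :
    ∀ o ∈ ((mdLoop γ η N m x acc).exec M).support, o.2 = 4 * m := by
  induction m generalizing x acc with
  | zero =>
    intro o ho
    rw [(PMF.mem_support_pure_iff _ _).1 ho]
  | succ m ih =>
    intro o ho
    simp only [mdLoop, GenProg.exec, PMF.mem_support_bind_iff, PMF.mem_support_map_iff] at ho
    obtain ⟨s₀, -, -, ⟨i, -, s', -, -, ⟨j, -, -, ⟨t', -, o', ho', rfl⟩, rfl⟩, rfl⟩, rfl⟩ := ho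
    simp only [ih _ _ o' ho', mul_add, mul_one]

end OutputLaw

theorem toOuterMeasure_bind_le {α β : Type*} [Fintype α] (p : PMF α) (q : α → PMF β) (s : Set β)
    {f : α → ℝ} (hf : ∀ a, 0 ≤ f a)
    (h : ∀ a, (q a).toOuterMeasure s ≤ ENNReal.ofReal (f a)) :
    (p.bind q).toOuterMeasure s ≤ ENNReal.ofReal (mean p f) := by
  rw [PMF.toOuterMeasure_bind_apply, tsum_fintype, mean, dotProduct,
    ENNReal.ofReal_sum_of_nonneg fun a _ => mul_nonneg ENNReal.toReal_nonneg (hf a)]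
  refine Finset.sum_le_sum fun a _ => ?_
  rw [ENNReal.ofReal_mul ENNReal.toReal_nonneg, ENNReal.ofReal_toReal (p.apply_ne_top a)]
  exact mul_le_mul_right (h a) _

section Certificate

variable {S A : Type*} [Fintype S] [Fintype A] {γ η : ℝ} {M : MDP S A} {π' : Policy S A}

theorem neg_horizon_le_dotProduct_advantage (h0 : 0 ≤ γ) (h1 : γ < 1) {μ : S × A → ℝ}
    (hμ : μ ∈ stdSimplex ℝ (S × A)) {v : S → ℝ} (hv : ∀ s, v s ∈ Set.Icc (0 : ℝ) 1) :
    -horizon γ ≤ μ ⬝ᵥ advantage γ M v := by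
  have advantage_mem (i : S × A) :
      advantage γ M v i ∈ Set.Icc (-horizon γ) (horizon γ) := by
    have loss_mem := mean_mem_Icc (M.trans i.1 i.2) (sampledLoss_mem_Icc h0 h1 M hv i)
    rw [mean_sampledLoss] at loss_mem
    exact ⟨by linarith [loss_mem.2], by linarith [loss_mem.1]⟩
  exact (dotProduct_mem_Icc hμ advantage_mem).1

/-- The state of mirror descent after `n` rounds, seen from a comparator policy `π'`: `x` is the
current decision, `acc` the sum of the earlier ones, `u` the ghost point, and `W` bounds the
regret so far plus the current potential, against every value function `q`. -/
structure RegretCertificate (γ η : ℝ) (M : MDP S A) (π' : Policy S A) (n : ℕ) (x : Decision S A)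
    (acc : Vec S A) (u : S → ℝ) (W : ℝ) : Prop where
  pos : ∀ i, 0 < x.1.2 i
  acc_nonneg : ∀ i, 0 ≤ acc.2 i
  ghost_mem : ∀ s, u s ∈ Set.Icc (0 : ℝ) 1
  regret_le : ∀ q : S → ℝ, (∀ s, q s ∈ Set.Icc (0 : ℝ) 1) →
    n * (initMean M (value γ M π') - initMean M q) - acc.2 ⬝ᵥ advantage γ M q ≤
      W - potential η (q, occupancy γ M π') x.1 u

variable [Nonempty S] [Nonempty A]

theorem RegretCertificate.gap_le (h0 : 0 ≤ γ) (h1 : γ < 1) (hη : 0 < η) {n : ℕ}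
    {x : Decision S A} {acc : Vec S A} {u : S → ℝ} {W : ℝ}
    (h : RegretCertificate γ η M π' n x acc u W) {c : ℝ} (hc : 0 < c) :
    (n + 1) * (initMean M (value γ M π') -
        initMean M (value γ M (flowPolicy (c • (acc + x.1)).2))) ≤ W + 2 * horizon γ := by
  set q := value γ M (flowPolicy (c • (acc + x.1)).2)
  have q_mem : ∀ s, q s ∈ Set.Icc (0 : ℝ) 1 := value_mem_Icc M _ h0 h1
  have occupancy_mem := occupancy_mem_stdSimplex M π' h0 h1
  have potential_nonneg : 0 ≤ potential η (q, occupancy γ M π') x.1 u := by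
    have klSum_nonneg := klSum_nonneg h.pos occupancy_mem.1 (occupancy_mem.2.trans x.2.2.2.symm)
    rw [potential, one_div_mul_bregman]
    positivity
  have total_advantage : acc.2 ⬝ᵥ advantage γ M q + x.1.2 ⬝ᵥ advantage γ M q = 0 := by
    have scaled : c • (acc.2 + x.1.2) ⬝ᵥ advantage γ M q = 0 :=
      dotProduct_advantage_value_flowPolicy h0 h1 M fun i =>
        mul_nonneg hc.le (add_nonneg (h.acc_nonneg i) (h.pos i).le)
    rw [smul_dotProduct, add_dotProduct] at scaled
    exact (smul_eq_zero.1 scaled).resolve_left hc.ne'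
  linarith [h.regret_le q q_mem, neg_horizon_le_dotProduct_advantage (M := M) h0 h1 x.2.2 q_mem,
    (initMean_value_mem_Icc M π' h0 h1).2, (mean_mem_Icc M.init q_mem).1, one_le_horizon h0 h1,
    show initMean M q = mean M.init q from rfl]

theorem RegretCertificate.succ (h0 : 0 ≤ γ) (h1 : γ < 1) (hη : 0 < η) {n : ℕ}
    {x : Decision S A} {acc : Vec S A} {u : S → ℝ} {W : ℝ}
    (h : RegretCertificate γ η M π' n x acc u W) (ω : RoundSample S A) :
    RegretCertificate γ η M π' (n + 1) (mdStep η (roundGradient γ M x.1 ω) x) (acc + x.1)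
      (ghostStep γ η M x u ω) (W + roundIncrement γ η M (occupancy γ M π') x u ω) where
  pos := by
    rw [mdStep_eq_explicitStep hη _ h.pos]
    exact expUpdate_pos _ _ h.pos
  acc_nonneg i := add_nonneg (h.acc_nonneg i) (h.pos i).le
  ghost_mem := cubeStep_mem_Icc _ _ _
  regret_le q hq := by
    have round_le := regret_round_le h0 h1 hη M h.pos u ω (z := (q, occupancy γ M π'))
      ⟨hq, occupancy_mem_stdSimplex M π' h0 h1⟩
    rw [lagrangian_occupancy M π' h0 h1, lagrangian] at round_le
    rw [Prod.snd_add, add_dotProduct]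
    push_cast
    linarith [h.regret_le q hq]

theorem RegretCertificate.initial (h0 : 0 ≤ γ) (h1 : γ < 1) (hη : 0 < η) (M : MDP S A)
    (π' : Policy S A) {v₁ : S → ℝ} (hv₁ : ∀ s, 0 ≤ v₁ s ∧ v₁ s ≤ 1) :
    RegretCertificate γ η M π' 0 (initialDecision v₁ hv₁) 0 v₁
      (1 / η * (1 + Real.log (Fintype.card (S × A)))) where
  pos i := one_div_pos.2 (Nat.cast_pos.2 Fintype.card_pos)
  acc_nonneg _ := le_rfl
  ghost_mem := hv₁
  regret_le q hq := by
    have sum_sq_le : ∑ s, (q s - v₁ s) ^ 2 ≤ Fintype.card S := by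
      calc ∑ s, (q s - v₁ s) ^ 2 ≤ ∑ _s : S, (1 : ℝ) := Finset.sum_le_sum fun s _ => by
            have dist_le := Real.dist_le_of_mem_Icc (hq s) (hv₁ s)
            rwa [sq_le_one_iff_abs_le_one, ← Real.dist_eq, ← sub_zero 1]
        _ = Fintype.card S := by rw [Finset.sum_const, Finset.card_univ, nsmul_one]
    have klSum_le := mul_le_mul_of_nonneg_left
      (klSum_uniform_le (occupancy_mem_stdSimplex M π' h0 h1)) (one_div_pos.2 hη).le
    have cube_le : 1 / (2 * (η * Fintype.card S)) * ∑ s, (q s - v₁ s) ^ 2 ≤ 1 / η * (1 / 2) := by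
      calc _ ≤ 1 / (2 * (η * Fintype.card S)) * (Fintype.card S : ℝ) := by gcongr
        _ = _ := by field_simp
    have potential_eq : potential η (q, occupancy γ M π') (initialDecision v₁ hv₁).1 v₁ =
        1 / (2 * (η * Fintype.card S)) * ∑ s, (q s - v₁ s) ^ 2
          + 1 / η * klSum (occupancy γ M π') (fun _ => 1 / (Fintype.card (S × A) : ℝ))
          + 1 / (2 * (η * Fintype.card S)) * ∑ s, (q s - v₁ s) ^ 2 := by
      rw [potential, one_div_mul_bregman]
      rfl
    rw [potential_eq, Nat.cast_zero, zero_mul, Prod.snd_zero, zero_dotProduct]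
    linarith

theorem outputLaw_mdLoop_tail_le (h0 : 0 ≤ γ) (h1 : γ < 1) (hη : 0 < η) {l E : ℝ} (hl : 0 ≤ l)
    (hE : ∀ (x : Decision S A) (u : S → ℝ), (∀ s, u s ∈ Set.Icc (0 : ℝ) 1) →
      mean (roundLaw M x) (fun ω =>
        Real.exp (l * roundIncrement γ η M (occupancy γ M π') x u ω)) ≤ Real.exp E)
    {N m n : ℕ} (hN : n + m + 1 = N) {x : Decision S A} {acc : Vec S A} {u : S → ℝ} {W : ℝ}
    (h : RegretCertificate γ η M π' n x acc u W) (T : ℝ) :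
    (outputLaw M (mdLoop γ η N m x acc)).toOuterMeasure
        {π | T < N * (initMean M (value γ M π') - initMean M (value γ M π))} ≤
      ENNReal.ofReal (Real.exp (l * (W + 2 * horizon γ - T) + m * E)) := by
  induction m generalizing n x acc u W with
  | zero =>
    have N_pos : 0 < (N : ℝ) := Nat.cast_pos.2 (by omega)
    have gap_le := h.gap_le h0 h1 hη (one_div_pos.2 N_pos)
    have succ_eq : (n : ℝ) + 1 = N := by rw [← hN, add_zero, Nat.cast_succ]
    rw [mdLoop, outputLaw_done, PMF.toOuterMeasure_pure_apply]
    split_ifs with tail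
    · rw [← ENNReal.ofReal_one]
      refine ENNReal.ofReal_le_ofReal (Real.one_le_exp ?_)
      rw [Set.mem_ofPred_eq, ← succ_eq] at tail
      rw [succ_eq] at gap_le tail
      rw [Nat.cast_zero, zero_mul, add_zero]
      exact mul_nonneg hl (by linarith)
    · exact zero_le
  | succ m ih =>
    rw [outputLaw_mdLoop_succ]
    refine (toOuterMeasure_bind_le _ _ _ (fun ω => (Real.exp_pos _).le) fun ω =>
      ih (by omega) (h.succ h0 h1 hη ω)).trans (ENNReal.ofReal_le_ofReal ?_)
    calc mean (roundLaw M x) (fun ω => Real.exp (l *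
            (W + roundIncrement γ η M (occupancy γ M π') x u ω + 2 * horizon γ - T) + m * E))
        = Real.exp (l * (W + 2 * horizon γ - T) + m * E) * mean (roundLaw M x) (fun ω =>
            Real.exp (l * roundIncrement γ η M (occupancy γ M π') x u ω)) := by
          rw [← mean_const_mul]
          congr 1
          funext ω
          rw [← Real.exp_add]
          ring_nf
      _ ≤ Real.exp (l * (W + 2 * horizon γ - T) + m * E) * Real.exp E :=
          mul_le_mul_of_nonneg_left (hE x u h.ghost_mem) (Real.exp_pos _).le
      _ = _ := by
          rw [← Real.exp_add]
          push_cast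
          ring_nf

end Certificate

/-! ### Sample complexity -/

theorem le_toOuterMeasure_of_compl_le {α : Type*} (p : PMF α) {s : Set α} {δ : ℝ} (hδ : 0 ≤ δ)
    (h : p.toOuterMeasure sᶜ ≤ ENNReal.ofReal δ) :
    ENNReal.ofReal (1 - δ) ≤ p.toOuterMeasure s := by
  have total : p.toOuterMeasure Set.univ = 1 :=
    (PMF.toOuterMeasure_apply_eq_one_iff p _).2 (Set.subset_univ _)
  rw [ENNReal.ofReal_sub _ hδ, ENNReal.ofReal_one, tsub_le_iff_right, ← total,
    ← Set.union_compl_self s]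
  exact (MeasureTheory.measure_union_le s sᶜ).trans (by gcongr)

/- With `l = √L / (10 H R)`, the noise contributes at most `1.2 √L + 0.88 L` to the exponent,
and the threshold on the regret `-3.4 L`. -/
theorem concentration_exponent_le {K N H L R m : ℝ} (hK : 1 ≤ K) (hL : 1 ≤ L) (hH : 0 < H)
    (hR : 1 ≤ R) (hRKN : R ^ 2 = K * N) (hmN : m ≤ N) :
    √L / (10 * (H * R)) *
        (H * R * (1 + Real.log K) + 2 * H - H * R * √L * (34 + Real.log K)) +
      m * (√L / (10 * (H * R)) * (12 * (1 / (H * R) * (K * H ^ 2))) +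
        (√L / (10 * (H * R))) ^ 2 * (88 * (K * H ^ 2))) ≤ -L := by
  have : 0 < R := by linarith
  have L_sq : √L ^ 2 = L := Real.sq_sqrt (by linarith)
  have one_le_sqrt : 1 ≤ √L := Real.one_le_sqrt.2 hL
  have log_nonneg := Real.log_nonneg hK
  have first_le : √L / (10 * (H * R)) *
      (H * R * (1 + Real.log K) + 2 * H - H * R * √L * (34 + Real.log K)) ≤
        √L / 10 * (3 - 34 * √L) := by
    have H_le : H ≤ H * R := le_mul_of_one_le_right hH.le hR
    have log_le := mul_le_mul_of_nonneg_left
      (le_mul_of_one_le_left log_nonneg one_le_sqrt) (by positivity : 0 ≤ H * R)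
    calc _ ≤ √L / (10 * (H * R)) * (H * R * (3 - 34 * √L)) := by gcongr; linarith
      _ = _ := by field_simp
  have second_le : m * (√L / (10 * (H * R)) * (12 * (1 / (H * R) * (K * H ^ 2))) +
      (√L / (10 * (H * R))) ^ 2 * (88 * (K * H ^ 2))) ≤ √L * (12 / 10) + L * (88 / 100) := by
    calc _ ≤ N * (√L / (10 * (H * R)) * (12 * (1 / (H * R) * (K * H ^ 2))) +
          (√L / (10 * (H * R))) ^ 2 * (88 * (K * H ^ 2))) := by gcongr
      _ = (K * N) / R ^ 2 * (√L * (12 / 10) + √L ^ 2 * (88 / 100)) := by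
          field_simp
          ring
      _ = √L * (12 / 10) + L * (88 / 100) := by
          rw [← hRKN, L_sq, div_self (by positivity), one_mul]
  nlinarith

section LogarithmicFactor

variable {K L N d : ℝ}

theorem half_le_log_two_add_div (hK : 0 ≤ K) (hd : 0 < d) : 1 / 2 ≤ Real.log (2 + K / d) := by
  have log_two_le : Real.log 2 ≤ Real.log (2 + K / d) :=
    Real.log_le_log two_pos (le_add_of_nonneg_right (by positivity))
  linarith [Real.log_two_gt_d9]

theorem log_le_log_two_add_div (hK : 0 < K) (hd : 0 < d) (hd1 : d ≤ 1) :
    Real.log K ≤ Real.log (2 + K / d) := by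
  have K_le : K ≤ K / d := le_div_self hK.le hd hd1
  exact Real.log_le_log hK (by linarith)

theorem mul_le_of_log_factor_le (hK : 0 ≤ K) (hL : 0 ≤ L) (hN : 0 ≤ N) (hd : 0 < d) (hd1 : d ≤ 1)
    (h : 20000 * (K * L) * Real.log (2 + K / d) ^ 2 ≤ N * d ^ 2) : K * L ≤ N := by
  have log_sq_ge : (1 / 2) ^ 2 ≤ Real.log (2 + K / d) ^ 2 :=
    pow_le_pow_left₀ (by norm_num) (half_le_log_two_add_div hK hd) 2
  calc K * L ≤ 20000 * (K * L) * (1 / 2) ^ 2 := by nlinarith [mul_nonneg hK hL]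
    _ ≤ 20000 * (K * L) * Real.log (2 + K / d) ^ 2 := by gcongr
    _ ≤ N * d ^ 2 := h
    _ ≤ N := mul_le_of_le_one_right hN (pow_le_one₀ hd.le hd1)

theorem regret_bound_le_of_log_factor_le (hK : 1 ≤ K) (hL : 0 ≤ L) (hN : 0 ≤ N) (hd : 0 < d)
    (hd1 : d ≤ 1) (h : 20000 * (K * L) * Real.log (2 + K / d) ^ 2 ≤ N * d ^ 2) :
    √(K * N) * √L * (34 + Real.log K) ≤ N * (d / 2) := by
  have K_pos : 0 < K := by linarith
  have log_nonneg := Real.log_nonneg hK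
  have sum_le : 34 + Real.log K ≤ 69 * Real.log (2 + K / d) := by
    linarith [half_le_log_two_add_div K_pos.le hd, log_le_log_two_add_div K_pos hd hd1]
  refine (pow_le_pow_iff_left₀ (by positivity) (by positivity) two_ne_zero).1 ?_
  calc (√(K * N) * √L * (34 + Real.log K)) ^ 2 = K * N * L * (34 + Real.log K) ^ 2 := by
        rw [mul_pow, mul_pow, Real.sq_sqrt (by positivity), Real.sq_sqrt hL]
    _ ≤ K * N * L * (69 * Real.log (2 + K / d)) ^ 2 := by gcongr
    _ = 4761 * (K * L * Real.log (2 + K / d) ^ 2) * N := by ring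
    _ ≤ 5000 * (K * L * Real.log (2 + K / d) ^ 2) * N := by gcongr; norm_num
    _ = 20000 * (K * L) * Real.log (2 + K / d) ^ 2 * (N / 4) := by ring
    _ ≤ N * d ^ 2 * (N / 4) := by gcongr
    _ = (N * (d / 2)) ^ 2 := by ring

end LogarithmicFactor

section Rate

variable {S A : Type*} [Fintype S] [Fintype A] {γ : ℝ}

theorem normalizedRate_eq_div (C : ℝ) (k : ℕ) (γ ε δ : ℝ) :
    normalizedRate C k S A γ ε δ =
      C * (Fintype.card (S × A) * max 1 (Real.log (1 / δ))) *
        Real.log (2 + Fintype.card (S × A) / ((1 - γ) * ε)) ^ k / ((1 - γ) * ε) ^ 2 := by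
  rw [normalizedRate, Fintype.card_prod, Nat.cast_mul]
  ring

theorem unnormalizedRate_eq (C : ℝ) (k : ℕ) (γ ε δ : ℝ) :
    unnormalizedRate C k S A γ ε δ = normalizedRate C k S A γ ((1 - γ) * ε) δ := by
  rw [unnormalizedRate, normalizedRate]
  ring_nf

theorem normalizedRate_nonneg {C : ℝ} (hC : 0 ≤ C) (k : ℕ) (h1 : γ < 1) {ε : ℝ} (hε : 0 < ε)
    (δ : ℝ) : 0 ≤ normalizedRate C k S A γ ε δ := by
  have scale_pos : 0 < (1 - γ) * ε := mul_pos (sub_pos.2 h1) hε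
  have log_pos := half_le_log_two_add_div (Nat.cast_nonneg (Fintype.card (S × A))) scale_pos
  rw [normalizedRate_eq_div]
  positivity

theorem isEpsOptimalUnnormalized_iff (h1 : γ < 1) (M : MDP S A) (ε : ℝ) (π : Policy S A) :
    IsEpsOptimalUnnormalized γ M ε π ↔ IsEpsOptimal γ M ((1 - γ) * ε) π := by
  have initMean_value (π : Policy S A) :
      initMean M (value γ M π) = (1 - γ) * initMean M (discountedValue γ M π) :=
    mean_const_mul M.init _ _
  refine forall_congr' fun π' => ?_
  rw [initMean_value, initMean_value, ← mul_sub, mul_le_mul_iff_right₀ (sub_pos.2 h1)]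

theorem isEpsOptimal_of_one_le (h0 : 0 ≤ γ) (h1 : γ < 1) (M : MDP S A) {ε : ℝ} (hε : 1 ≤ ε)
    (π : Policy S A) : IsEpsOptimal γ M ε π := fun π' => by
  linarith [(initMean_value_mem_Icc M π' h0 h1).2, (initMean_value_mem_Icc M π h0 h1).1]

theorem exists_isEpsOptimal [Nonempty A] (h0 : 0 ≤ γ) (h1 : γ < 1) (M : MDP S A) {ε : ℝ}
    (hε : 0 < ε) : ∃ π, IsEpsOptimal γ M ε π := by
  have bddAbove : BddAbove (Set.range fun π => initMean M (value γ M π)) :=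
    ⟨1, by rintro _ ⟨π, rfl⟩; exact (initMean_value_mem_Icc M π h0 h1).2⟩
  have nonempty : Nonempty (Policy S A) := ⟨fun _ => PMF.uniformOfFintype A⟩
  obtain ⟨_, ⟨π, rfl⟩, near⟩ := exists_lt_of_lt_csSup
    (Set.range_nonempty fun π => initMean M (value γ M π)) (sub_lt_self _ hε)
  exact ⟨π, fun π' => by linarith [le_csSup bddAbove ⟨π', rfl⟩]⟩

theorem stepSize_eq (γ : ℝ) (N : ℕ) :
    (1 - γ) / √((Fintype.card S : ℝ) * (Fintype.card A : ℝ) * N) =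
      1 / (horizon γ * √(Fintype.card (S × A) * N)) := by
  rw [horizon, Fintype.card_prod, Nat.cast_mul, one_div, mul_inv, one_div, inv_inv,
    div_eq_mul_inv]

variable [Nonempty S] [Nonempty A]

theorem calls_mirrorDescentRL_le (M : MDP S A) {v₁ : S → ℝ} (hv₁ : ∀ s, 0 ≤ v₁ s ∧ v₁ s ≤ 1)
    {B : ℝ} (hB : 0 ≤ B) :
    ∀ o ∈ ((mirrorDescentRL γ v₁ hv₁ ⌈B⌉₊).exec M).support, (o.2 : ℝ) ≤ 4 * B := by
  intro o ho
  have rounds_le : ((⌈B⌉₊ - 1 : ℕ) : ℝ) ≤ B := by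
    rcases Nat.eq_zero_or_pos ⌈B⌉₊ with ceil_zero | ceil_pos
    · simpa only [ceil_zero, Nat.zero_sub, Nat.cast_zero]
    · rw [Nat.cast_pred ceil_pos, sub_le_iff_le_add]
      exact (Nat.ceil_lt_add_one hB).le
  rw [calls_mdLoop M _ _ _ _ _ _ o ho]
  push_cast
  gcongr

theorem mirrorDescentRL_regret_tail_le (h0 : 0 ≤ γ) (h1 : γ < 1) (M : MDP S A)
    (π' : Policy S A) {v₁ : S → ℝ} (hv₁ : ∀ s, 0 ≤ v₁ s ∧ v₁ s ≤ 1) {L : ℝ} (hL : 1 ≤ L) {N : ℕ}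
    (hN : Fintype.card (S × A) * L ≤ N) :
    (outputLaw M (mirrorDescentRL γ v₁ hv₁ N)).toOuterMeasure
        {π | horizon γ * √(Fintype.card (S × A) * N) * √L *
            (34 + Real.log (Fintype.card (S × A))) <
          N * (initMean M (value γ M π') - initMean M (value γ M π))} ≤
      ENNReal.ofReal (Real.exp (-L)) := by
  have H_pos : 0 < horizon γ := one_pos.trans_le (one_le_horizon h0 h1)
  have one_le_card : (1 : ℝ) ≤ Fintype.card (S × A) := Nat.one_le_cast.2 Fintype.card_pos
  rw [mirrorDescentRL, stepSize_eq]
  set H := horizon γ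
  set K : ℝ := (Fintype.card (S × A) : ℝ)
  set R := √(K * N) with hR
  have K_le_N : K ≤ N := (le_mul_of_one_le_right (by linarith) hL).trans hN
  have N_pos : 1 ≤ N := Nat.one_le_cast.1 (one_le_card.trans K_le_N)
  have sqrt_mul_K_le : √L * K ≤ R := by
    rw [hR, ← Real.sqrt_sq (by linarith : 0 ≤ K), ← Real.sqrt_mul (by linarith)]
    exact Real.sqrt_le_sqrt (by rw [Real.sqrt_sq (by linarith)]; nlinarith)
  have K_le_R : K ≤ R :=
    (le_mul_of_one_le_left (by linarith) (Real.one_le_sqrt.2 hL)).trans sqrt_mul_K_le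
  have : 0 < R := by linarith
  have step_le : 1 / (H * R) * (K * H) ≤ 1 := by
    rw [one_div_mul_eq_div, div_le_one (by positivity), mul_comm H R]
    gcongr
  have exponent_le : √L / (10 * (H * R)) * (8 * (K * H)) ≤ 1 := by
    rw [div_mul_eq_mul_div, div_le_one (by positivity)]
    nlinarith
  refine (outputLaw_mdLoop_tail_le h0 h1 (by positivity)
    (l := √L / (10 * (H * R))) (by positivity)
    (fun x u hu => mean_exp_roundIncrement_le M x h0 h1 (by positivity) step_le
      (occupancy_mem_stdSimplex M π' h0 h1) hu (by positivity) exponent_le)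
    (by omega) (.initial h0 h1 (by positivity) M π' hv₁) _).trans
    (ENNReal.ofReal_le_ofReal (Real.exp_le_exp.2 ?_))
  rw [one_div_one_div]
  exact concentration_exponent_le one_le_card hL H_pos (one_le_card.trans K_le_R)
    (Real.sq_sqrt (by positivity)) (Nat.cast_le.2 (Nat.sub_le N 1))

theorem mirrorDescentRL_failure_le (h0 : 0 ≤ γ) (h1 : γ < 1) {ε δ : ℝ} (hε : 0 < ε)
    (hε1 : ε ≤ 1) (hδ : 0 < δ) {v₁ : S → ℝ} (hv₁ : ∀ s, 0 ≤ v₁ s ∧ v₁ s ≤ 1) (M : MDP S A)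
    {N : ℕ} (hN : normalizedRate 20000 2 S A γ ε δ ≤ N) :
    (outputLaw M (mirrorDescentRL γ v₁ hv₁ N)).toOuterMeasure {π | IsEpsOptimal γ M ε π}ᶜ ≤
      ENNReal.ofReal δ := by
  set L := max 1 (Real.log (1 / δ))
  have one_le_L : 1 ≤ L := le_max_left _ _
  have one_le_card : (1 : ℝ) ≤ Fintype.card (S × A) := Nat.one_le_cast.2 Fintype.card_pos
  have scale_pos : 0 < (1 - γ) * ε := mul_pos (sub_pos.2 h1) hε
  have scale_le_one : (1 - γ) * ε ≤ 1 := mul_le_one₀ (by linarith) hε.le hε1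
  rw [normalizedRate_eq_div, div_le_iff₀ (by positivity)] at hN
  have card_mul_L_le := mul_le_of_log_factor_le (by positivity) (by positivity)
    (Nat.cast_nonneg N) scale_pos scale_le_one hN
  have regret_bound_le := regret_bound_le_of_log_factor_le one_le_card (by positivity)
    (Nat.cast_nonneg N) scale_pos scale_le_one hN
  obtain ⟨π', near_optimal⟩ := exists_isEpsOptimal h0 h1 M (half_pos hε)
  refine ((outputLaw M _).toOuterMeasure.mono fun π hπ => ?_).trans
    ((mirrorDescentRL_regret_tail_le h0 h1 M π' hv₁ one_le_L card_mul_L_le).trans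
      (ENNReal.ofReal_le_ofReal ?_))
  · obtain ⟨π'', gap⟩ : ∃ π'', ε < initMean M (value γ M π'') - initMean M (value γ M π) := by
      simpa only [Set.mem_compl_iff, Set.mem_ofPred_eq, IsEpsOptimal, not_forall, not_le] using hπ
    have N_pos : (0 : ℝ) < N := by nlinarith
    calc _ = horizon γ * (√(Fintype.card (S × A) * N) * √L *
            (34 + Real.log (Fintype.card (S × A)))) := by ring
      _ ≤ horizon γ * (N * ((1 - γ) * ε / 2)) := by
          gcongr
          linarith [one_le_horizon h0 h1]
      _ = (1 - γ) * horizon γ * (N * (ε / 2)) := by ring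
      _ = N * (ε / 2) := by rw [one_sub_mul_horizon h1, one_mul]
      _ < N * (initMean M (value γ M π') - initMean M (value γ M π)) := by
          gcongr
          linarith [near_optimal π'']
  · rw [← Real.le_log_iff_exp_le hδ, neg_le, ← Real.log_inv, ← one_div]
    exact le_max_right _ _

theorem mirrorDescentRL_isEpsOptimal (h0 : 0 ≤ γ) (h1 : γ < 1) {ε δ : ℝ} (hε : 0 < ε)
    (hδ : 0 < δ) {v₁ : S → ℝ} (hv₁ : ∀ s, 0 ≤ v₁ s ∧ v₁ s ≤ 1) (M : MDP S A) {N : ℕ}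
    (hN : normalizedRate 20000 2 S A γ ε δ ≤ N) :
    ENNReal.ofReal (1 - δ) ≤
      ((mirrorDescentRL γ v₁ hv₁ N).exec M).toOuterMeasure {o | IsEpsOptimal γ M ε o.1} := by
  refine le_toOuterMeasure_of_compl_le _ hδ.le ?_
  rcases le_or_gt ε 1 with ε_le_one | one_lt_ε
  · have failure_le := mirrorDescentRL_failure_le h0 h1 hε ε_le_one hδ hv₁ M hN
    rwa [outputLaw, PMF.toOuterMeasure_map_apply] at failure_le
  · simp [isEpsOptimal_of_one_le h0 h1 M one_lt_ε.le]

end Rate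

end

end MirrorRL

theorem mainTheorem5 :
    ∃ C : ℝ, 0 < C ∧ ∃ k : ℕ,
      ∀ (S : Type*) (A : Type*) [Fintype S] [Fintype A] [Nonempty S] [Nonempty A]
        (γ : ℝ), 0 ≤ γ → γ < 1 → ∀ ε : ℝ, 0 < ε → ∀ δ : ℝ, 0 < δ → δ < 1 →
      ∀ (v₁ : S → ℝ) (hv₁ : ∀ s, 0 ≤ v₁ s ∧ v₁ s ≤ 1) (M : MirrorRL.MDP S A),
        -- normalized returns: with at least the stated number of rounds the learned policy is
        -- `ε`-optimal with probability at least `1 - δ` ...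
        (∀ N : ℕ, MirrorRL.normalizedRate C k S A γ ε δ ≤ N →
          ENNReal.ofReal (1 - δ) ≤
            ((MirrorRL.mirrorDescentRL γ v₁ hv₁ N).exec M).toOuterMeasure
              {o | MirrorRL.IsEpsOptimal γ M ε o.1}) ∧
        -- ... and for the least such number the calls to the generative model are bounded
        (∀ o ∈ ((MirrorRL.mirrorDescentRL γ v₁ hv₁
              ⌈MirrorRL.normalizedRate C k S A γ ε δ⌉₊).exec M).support,
          (o.2 : ℝ) ≤ 4 * MirrorRL.normalizedRate C k S A γ ε δ) ∧
        -- the same for unnormalized returns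
        (∀ N : ℕ, MirrorRL.unnormalizedRate C k S A γ ε δ ≤ N →
          ENNReal.ofReal (1 - δ) ≤
            ((MirrorRL.mirrorDescentRL γ v₁ hv₁ N).exec M).toOuterMeasure
              {o | MirrorRL.IsEpsOptimalUnnormalized γ M ε o.1}) ∧
        (∀ o ∈ ((MirrorRL.mirrorDescentRL γ v₁ hv₁
              ⌈MirrorRL.unnormalizedRate C k S A γ ε δ⌉₊).exec M).support,
          (o.2 : ℝ) ≤ 4 * MirrorRL.unnormalizedRate C k S A γ ε δ) := by
  refine ⟨20000, by norm_num, 2, ?_⟩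
  intro S A _ _ _ _ γ h0 h1 ε hε δ hδ _ v₁ hv₁ M
  have scaled_pos : 0 < (1 - γ) * ε := mul_pos (sub_pos.2 h1) hε
  simp only [MirrorRL.unnormalizedRate_eq, MirrorRL.isEpsOptimalUnnormalized_iff h1]
  exact ⟨fun N hN => MirrorRL.mirrorDescentRL_isEpsOptimal h0 h1 hε hδ hv₁ M hN,
    MirrorRL.calls_mirrorDescentRL_le M hv₁
      (MirrorRL.normalizedRate_nonneg (by norm_num) 2 h1 hε δ),
    fun N hN => MirrorRL.mirrorDescentRL_isEpsOptimal h0 h1 scaled_pos hδ hv₁ M hN,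
    MirrorRL.calls_mirrorDescentRL_le M hv₁
      (MirrorRL.normalizedRate_nonneg (by norm_num) 2 h1 scaled_pos δ)⟩
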